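/- Let $\mathbb D=\{z\in\mathbb C:|z|<1\}$, and let $\wp\subset\mathbb D$ be a simple loop (the image of the unit circle under a continuous injective map) at positive distance from $0$ that surrounds $0$, i.e. the connected component $U$ of $\mathbb C\setminus\wp$ containing $0$ is bounded. Let $\operatorname{CR}(0,\mathbb D\setminus\wp)$ be the conformal radius of $U$ seen from $0$, that is, $1/\phi'(0)$, where $\phi:U\to\mathbb D$ is the conformal bijection with $\phi(0)=0$ and $\phi'(0)>0$. Let $\operatorname{ED}(\partial\mathbb D,\wp)$ be the extremal distance between $\partial\mathbb D$ and $\wp$ in the annular domain $A=\mathbb D\setminus(\wp\cup U)$, that is, $$\operatorname{ED}(\partial\mathbb D,\wp)=\sup_\rho\frac{\bigl(\inf_c\int_c\rho\,|dz|\bigr)^2}{\int_A\rho^2\,dx\,dy},$$ where $\rho\ge 0$ ranges over the Borel functions with $0<\int_A\rho^2\,dx\,dy<\infty$ and $c$ over the rectifiable curves in $A$ that join $\partial\mathbb D$ to $\wp$ (endpoints on $\partial\mathbb D$ and $\wp$, all other points in $A$); with this normalization $\operatorname{ED}(\partial\mathbb D,r\partial\mathbb D)=\frac1{2\pi}\log\frac1r$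 for $0<r<1$. Then $$\operatorname{ED}(\partial\mathbb D,\wp)\le-\frac1{2\pi}\log\operatorname{CR}(0,\mathbb D\setminus\wp).$$ -/

import Mathlib

open Set Metric MeasureTheory
open scoped ENNReal NNReal

noncomputable section

/-- `φ` is a conformal (holomorphic and bijective) map from `D` onto the open unit disc with
`φ z = 0` and `φ' z > 0`. -/
def IsNormalizedRiemannMap (D : Set ℂ) (z : ℂ) (φ : ℂ → ℂ) : Prop :=
  DifferentiableOn ℂ φ D ∧ BijOn φ D (ball 0 1) ∧ φ z = 0 ∧
    0 < (deriv φ z).re ∧ (deriv φ z).im = 0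

open Classical in
/-- The conformal radius of `D` seen from `z`: the number `1 / φ' z`, where `φ` is the conformal map
from `D` onto the unit disc with `φ z = 0` and `φ' z > 0` (equivalently, the derivative at `0` of
`φ⁻¹`). For a simply connected domain `D ≠ ℂ` containing `z` there is exactly one such `φ` on `D`;
the value `0` is taken if there is none. -/
def conformalRadius (z : ℂ) (D : Set ℂ) : ℝ :=
  if h : ∃ φ : ℂ → ℂ, IsNormalizedRiemannMap D z φ then ((deriv h.choose z).re)⁻¹ else 0

/-- The rectifiable curves in `Ω` that join `E` and `F`: one endpoint lies in `E`, the other in `F`,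
and all other points in `Ω`. A rectifiable curve is given by a Lipschitz parametrization on `[0,1]`
(for instance the one with constant speed). -/
def joiningCurves (Ω E F : Set ℂ) : Set (ℝ → ℂ) :=
  {c | (∃ K : ℝ≥0, LipschitzOnWith K c (Icc 0 1)) ∧ c 0 ∈ E ∧ c 1 ∈ F ∧ ∀ t ∈ Ioo (0 : ℝ) 1, c t ∈ Ω}

/-- The `ρ`-length `∫_c ρ |dz|` of a Lipschitz curve `c : [0,1] → ℂ`. -/
def curveLength (ρ : ℂ → ℝ≥0∞) (c : ℝ → ℂ) : ℝ≥0∞ :=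
  ∫⁻ t in Ioo (0 : ℝ) 1, ρ (c t) * ‖deriv c t‖ₑ

/-- The `ρ`-area `∫_Ω ρ² dx dy` of `Ω`. -/
def metricArea (ρ : ℂ → ℝ≥0∞) (Ω : Set ℂ) : ℝ≥0∞ :=
  ∫⁻ z in Ω, ρ z ^ 2

/-- The extremal distance between `E` and `F` in the open set `Ω`: the extremal length
`sup_ρ L(ρ)² / A(ρ)` of the family of curves in `Ω` joining `E` and `F`, where `ρ` ranges over the
Borel densities with `0 < A(ρ) < ∞`, `A(ρ)` is the `ρ`-area of `Ω`, and `L(ρ)` is the infimum of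
the `ρ`-lengths of the curves of the family. -/
def extremalDistance (Ω E F : Set ℂ) : ℝ≥0∞ :=
  ⨆ (ρ : ℂ → ℝ≥0∞) (_ : Measurable ρ) (_ : metricArea ρ Ω ≠ 0) (_ : metricArea ρ Ω ≠ ∞),
    (⨅ c ∈ joiningCurves Ω E F, curveLength ρ c) ^ 2 / metricArea ρ Ω

/-- For a loop `P` surrounding `0`, the domain surrounded by `P`: the connected component of `ℂ ∖ P`
that contains `0`. -/
def surroundedDomain (P : Set ℂ) : Set ℂ := connectedComponentIn Pᶜ 0

/-- A simple loop `P` surrounds `0` if `0` is not on the loop and lies in a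
bounded connected component of its complement. -/
def SurroundsZero (P : Set ℂ) : Prop := (0 : ℂ) ∉ P ∧ Bornology.IsBounded (surroundedDomain P)

/-- For a simple loop `P` in the unit disc surrounding `0`, the annular domain with outer boundary
the unit circle and inner boundary `P`. -/
def annularDomain (P : Set ℂ) : Set ℂ := ball 0 1 \ (P ∪ surroundedDomain P)

end

/-! Let U be the domain surrounded by the loop, φ its normalized Riemann map and g the inverse of φ.
The bound comes from two estimates for the measure dx dy/|z|² (`logArea`) of a set G, the part of
the unit disc outside the radial hull of the loop.

Length and area: on each ray from 0, the segment from the unit circle in to the outermost point of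
the loop is a joining curve, and its interior lies in G (`iInf_curveLength_le`). If every such
segment has ρ-length at least L, integration over the angle and the Cauchy–Schwarz inequality give
(2πL)² ≤ A(ρ) · logArea G (`sq_two_pi_mul_le`).

Area: logArea G ≤ 2π log φ'(0) (`logArea_le_of_isNormalizedRiemannMap`). The function w g'(w)/g(w)
extends holomorphically to the disc with value 1 at 0, so its square has mean 1 on every circle
about 0. Hence g maps δ < |w| < 1 onto a set of logarithmic area at least 2π log(1/δ)
(`le_logArea_image_annulus`). For δ slightly larger than φ'(0)m this image lies in m ≤ |z| < 1, as
does G, and is disjoint from G; that annulus has logarithmic area 2π log(1/m). Subtract and let m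
tend to 0.

Together, L²/A(ρ) ≤ log φ'(0)/(2π), and CR = 1/φ'(0). Since the conformal radius has a default
value, the existence of φ must be proved as well. This is Koebe's proof of the Riemann mapping
theorem, with simple connectivity expressed by connectedness of the complement in the closed disc
(`IsDiscDomain`). -/

/-! ### Connectedness criteria -/

/-- A closed subset `C` of a preconnected set `S` is preconnected if it consists of a preconnected
set and of a relatively open subset of `S`. -/
theorem isPreconnected_of_isOpen_inter_subset {α : Type*} [TopologicalSpace α] {S C E O : Set α}
    (hS : IsPreconnected S) (hC : IsClosed C) (hCS : ¬ S ⊆ C) (hE : IsPreconnected E) (hEC : E ⊆ C)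
    (hO : IsOpen O) (hOC : O ∩ S ⊆ C) (hCO : C ⊆ E ∪ O) (hC' : C ⊆ S) : IsPreconnected C := by
  rw [isPreconnected_iff_subset_of_disjoint_closed]
  have key : ∀ u v : Set α, IsClosed u → IsClosed v → C ⊆ u ∪ v → C ∩ (u ∩ v) = ∅ → E ⊆ u →
      C ⊆ u := by
    intro u v hu hv huv hd hEu
    -- The closed sets `C ∩ v` and `(O \ u)ᶜ` cover `S` without overlap there. The first cannot
    -- contain `S`, so `O \ u` misses `S`, which leaves `C` inside `u`.
    have h := isPreconnected_iff_subset_of_disjoint_closed.1 hS (C ∩ v) ((O \ u)ᶜ) (hC.inter hv)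
      (hO.sdiff hu).isClosed_compl ?_ ?_
    · rcases h with h | h
      · exact absurd (h.trans inter_subset_left) hCS
      · intro x hx
        by_contra hxu
        rcases hCO hx with hxE | hxO
        · exact hxu (hEu hxE)
        · exact h (hC' hx) ⟨hxO, hxu⟩
    · intro x hx
      by_cases hxO : x ∈ O \ u
      · have := hOC ⟨hxO.1, hx⟩
        exact Or.inl ⟨this, (huv this).resolve_left hxO.2⟩
      · exact Or.inr hxO
    · ext x
      simp only [mem_inter_iff, mem_compl_iff, mem_sdiff, not_and, not_not, mem_empty_iff_false,
        iff_false]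
      rintro hxS ⟨hxC, hxv⟩ hxO
      have hxu : x ∈ u := by
        rcases hCO hxC with h | h
        · exact hEu h
        · exact hxO h
      exact (eq_empty_iff_forall_notMem.1 hd x) ⟨hxC, hxu, hxv⟩
  intro u v hu hv huv hd
  rcases isPreconnected_iff_subset_of_disjoint_closed.1 hE u v hu hv (hEC.trans huv)
    (subset_eq_empty (inter_subset_inter_left _ hEC) hd) with h | h
  · exact Or.inl (key u v hu hv huv hd h)
  · exact Or.inr (key v u hv hu (by rwa [union_comm]) (by rwa [inter_comm v u]) h)

/-- The preimage of a compact connected set containing `0` under squaring is connected. -/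
theorem isPreconnected_preimage_sq {C : Set ℂ} (hC : IsPreconnected C) (hCc : IsCompact C)
    (h0 : (0 : ℂ) ∈ C) : IsPreconnected ((fun z : ℂ ↦ z ^ 2) ⁻¹' C) := by
  set E := (fun z : ℂ ↦ z ^ 2) ⁻¹' C with hE
  have hcl : IsClosed E := hCc.isClosed.preimage (by fun_prop)
  have hEc : IsCompact E := by
    refine isCompact_of_isClosed_isBounded hcl ?_
    obtain ⟨M, hM⟩ := hCc.isBounded.exists_norm_le
    refine isBounded_iff_forall_norm_le.2 ⟨M + 1, fun z hz ↦ ?_⟩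
    have := hM _ hz
    simp only [norm_pow] at this
    nlinarith [norm_nonneg z, sq_nonneg (‖z‖ - 1)]
  have hopen : IsOpenMap (fun z : ℂ ↦ z ^ 2) := (Complex.isOpenQuotientMap_pow 2).isOpenMap
  rw [isPreconnected_iff_subset_of_disjoint_closed]
  have key : ∀ u v : Set ℂ, IsClosed u → IsClosed v → E ⊆ u ∪ v → E ∩ (u ∩ v) = ∅ →
      (0 : ℂ) ∈ u → E ⊆ u := by
    intro u v hu hv huv hd h0u
    have h0E : (0 : ℂ) ∈ E := by simpa [hE] using h0
    -- The first set is closed by compactness, the second because squaring is open. The point 0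
    -- decides between them: its only square root lies in `u`.
    have h := isPreconnected_iff_subset_of_disjoint_closed.1 hC ((fun z : ℂ ↦ z ^ 2) '' (E ∩ v))
      (((fun z : ℂ ↦ z ^ 2) '' uᶜ)ᶜ) ((hEc.inter_right hv).image (by fun_prop)).isClosed
      (hopen _ hu.isOpen_compl).isClosed_compl ?_ ?_
    · rcases h with h | h
      · obtain ⟨z, ⟨-, hzv⟩, hz⟩ := h h0
        have hz0 : z = 0 := by simpa using hz
        subst hz0
        exact absurd ⟨h0E, h0u, hzv⟩ (eq_empty_iff_forall_notMem.1 hd 0)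
      · intro x hx
        by_contra hxu
        exact h hx ⟨x, hxu, rfl⟩
    · intro x hx
      by_cases hxu : x ∈ (fun z : ℂ ↦ z ^ 2) '' uᶜ
      · obtain ⟨z, hz, rfl⟩ := hxu
        exact Or.inl ⟨z, ⟨hx, (huv hx).resolve_left hz⟩, rfl⟩
      · exact Or.inr hxu
    · refine eq_empty_iff_forall_notMem.2 ?_
      rintro _ ⟨-, ⟨z, ⟨hzE, hzv⟩, rfl⟩, h2⟩
      exact h2 ⟨z, fun hzu ↦ (eq_empty_iff_forall_notMem.1 hd z) ⟨hzE, hzu, hzv⟩, rfl⟩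
  intro u v hu hv huv hd
  rcases huv (show (0 : ℂ) ∈ E by simpa [hE] using h0) with h | h
  · exact Or.inl (key u v hu hv huv hd h)
  · exact Or.inr (key v u hv hu (by rwa [union_comm]) (by rwa [inter_comm v u]) h)

/-! ### Disc domains and branches of the square root -/

/-- `V` is an open set in the unit disc whose complement in the closed disc is connected. -/
structure IsDiscDomain (V : Set ℂ) : Prop where
  isOpen : IsOpen V
  isPreconnected : IsPreconnected V
  subset_ball : V ⊆ ball 0 1
  isPreconnected_compl : IsPreconnected (closedBall 0 1 \ V)

theorem exists_continuousOn_sq_eq_one_add {W : Set ℂ} {q : ℂ → ℂ} (hq : ContinuousOn q W)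
    (h : ∀ z ∈ W, ‖q z‖ < 1) : ∃ t : ℂ → ℂ, ContinuousOn t W ∧ ∀ z ∈ W, t z ^ 2 = 1 + q z := by
  have hs : ∀ z ∈ W, 1 + q z ∈ Complex.slitPlane := fun z hz ↦
    Complex.mem_slitPlane_of_norm_lt_one (h z hz)
  refine ⟨fun z ↦ Complex.exp (Complex.log (1 + q z) / 2), ?_, fun z hz ↦ ?_⟩
  · exact (((continuousOn_const.add hq).clog hs).div_const 2).cexp
  · rw [← Complex.exp_nat_mul]
    push_cast
    rw [mul_div_cancel₀ _ two_ne_zero, Complex.exp_log (Complex.slitPlane_ne_zero (hs z hz))]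

/-- The points b off `V` for which z - b has a continuous root on `W` form a set that persists under
moves shorter than `δ`. It contains 1, so connectedness of the complement carries it to 0. -/
theorem IsDiscDomain.exists_sqrt_of_lt_infDist {V W : Set ℂ} (hV : IsDiscDomain V) (h0 : 0 ∉ V)
    {δ : ℝ} (hδ : 0 < δ) (hWV : W ⊆ V) (hW : ∀ z ∈ W, δ < infDist z Vᶜ) :
    ∃ s : ℂ → ℂ, ContinuousOn s W ∧ ∀ z ∈ W, s z ^ 2 = z := by
  set T : Set ℂ := {b | ∃ s : ℂ → ℂ, ContinuousOn s W ∧ ∀ z ∈ W, s z ^ 2 = z - b} with hT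
  have hdist : ∀ z ∈ W, ∀ b ∉ V, δ < ‖z - b‖ := fun z hz b hb ↦ by
    rw [← dist_eq_norm]; exact (hW z hz).trans_le (infDist_le_dist_of_mem hb)
  have hnear : ∀ b ∉ V, ∀ b' ∉ V, b ∈ T → dist b' b < δ → b' ∈ T := by
    rintro b hb b' hb' ⟨s, hs, hs2⟩ hbb
    have hne : ∀ z ∈ W, z - b ≠ 0 := fun z hz h ↦ by
      have := hdist z hz b hb
      rw [h, norm_zero] at this
      linarith
    -- z - b' = (z - b)(1 + (b - b')/(z - b)), where the quotient has norm less than 1.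
    obtain ⟨t, ht, ht2⟩ := exists_continuousOn_sq_eq_one_add (W := W)
      (q := fun z ↦ (b - b') / (z - b)) (by
        refine continuousOn_const.div (by fun_prop) hne) (fun z hz ↦ by
        rw [norm_div, div_lt_one (norm_pos_iff.2 (hne z hz)), ← dist_eq_norm, dist_comm]
        exact hbb.trans (hdist z hz b hb))
    refine ⟨fun z ↦ s z * t z, hs.mul ht, fun z hz ↦ ?_⟩
    have := hne z hz
    rw [mul_pow, hs2 z hz, ht2 z hz]
    field_simp
    ring
  have h1 : (1 : ℂ) ∈ T := by
    obtain ⟨t, ht, ht2⟩ := exists_continuousOn_sq_eq_one_add (W := W) (q := fun z ↦ -z)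
      (by fun_prop) (fun z hz ↦ by simpa using hV.subset_ball (hWV hz))
    refine ⟨fun z ↦ Complex.I * t z, continuousOn_const.mul ht, fun z hz ↦ ?_⟩
    rw [mul_pow, ht2 z hz, Complex.I_sq]
    ring
  have hopen : ∀ A : Set ℂ, IsOpen (⋃ b ∈ A, ball b (δ / 2)) := fun A ↦
    isOpen_biUnion fun _ _ ↦ isOpen_ball
  have h1S : (1 : ℂ) ∈ closedBall (0 : ℂ) 1 \ V := ⟨by simp, fun h ↦ by
    simpa using hV.subset_ball h⟩
  have h0S : (0 : ℂ) ∈ closedBall (0 : ℂ) 1 \ V := ⟨by simp, h0⟩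
  suffices (0 : ℂ) ∈ T by simpa [hT] using this
  by_contra h0T
  obtain ⟨x, hxS, hxu, hxv⟩ := hV.isPreconnected_compl
    (⋃ b ∈ (closedBall 0 1 \ V) ∩ T, ball b (δ / 2))
    (⋃ b ∈ (closedBall 0 1 \ V) \ T, ball b (δ / 2)) (hopen _) (hopen _)
    (fun b hb ↦ by
      by_cases hbT : b ∈ T
      · exact Or.inl (mem_biUnion (⟨hb, hbT⟩ : b ∈ _ ∩ T) (mem_ball_self (half_pos hδ)))
      · exact Or.inr (mem_biUnion (⟨hb, hbT⟩ : b ∈ _ \ T) (mem_ball_self (half_pos hδ))))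
    ⟨1, h1S, mem_biUnion (⟨h1S, h1⟩ : _ ∈ _ ∩ T) (mem_ball_self (half_pos hδ))⟩
    ⟨0, h0S, mem_biUnion (⟨h0S, h0T⟩ : _ ∈ _ \ T) (mem_ball_self (half_pos hδ))⟩
  simp only [mem_iUnion, exists_prop] at hxu hxv
  obtain ⟨b, ⟨hb, hbT⟩, hxb⟩ := hxu
  obtain ⟨b', ⟨hb', hbT'⟩, hxb'⟩ := hxv
  refine hbT' (hnear b hb.2 b' hb'.2 hbT ?_)
  calc dist b' b ≤ dist b' x + dist x b := dist_triangle _ _ _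
    _ < δ / 2 + δ / 2 := add_lt_add (by rwa [dist_comm]) hxb
    _ = δ := by ring

/-- The square root has a continuous branch on a disc domain that omits `0`. -/
theorem IsDiscDomain.exists_sqrt {V : Set ℂ} (hV : IsDiscDomain V) (h0 : 0 ∉ V) :
    ∃ s : ℂ → ℂ, ContinuousOn s V ∧ ∀ z ∈ V, s z ^ 2 = z := by
  rcases V.eq_empty_or_nonempty with rfl | ⟨x₀, hx₀⟩
  · exact ⟨id, by simp, by simp⟩
  set D : ℕ → Set ℂ := fun n ↦ {z | 1 / ((n : ℝ) + 1) < infDist z Vᶜ} with hD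
  have hne : (Vᶜ).Nonempty := ⟨0, h0⟩
  have hDopen : ∀ n, IsOpen (D n) := fun n ↦ isOpen_lt continuous_const (continuous_infDist_pt _)
  have hDV : ∀ n, D n ⊆ V := fun n z hz ↦ by
    by_contra hzV
    have h1 : infDist z Vᶜ = 0 := infDist_zero_of_mem hzV
    have h2 : (0 : ℝ) < 1 / ((n : ℝ) + 1) := by positivity
    have : 1 / ((n : ℝ) + 1) < infDist z Vᶜ := hz
    linarith
  have hDmono : Monotone D := fun m n hmn z hz ↦ by
    have h1 : 1 / ((m : ℝ) + 1) < infDist z Vᶜ := hz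
    have h2 : 1 / ((n : ℝ) + 1) ≤ 1 / ((m : ℝ) + 1) :=
      one_div_le_one_div_of_le (by positivity) (by
        have : (m : ℝ) ≤ n := by exact_mod_cast hmn
        linarith)
    exact h2.trans_lt h1
  -- On a connected set a branch is fixed by its value at `x₀`, so the branches on the `W n` agree
  -- and glue. `W n` is empty when `x₀ ∉ D n`.
  set W : ℕ → Set ℂ := fun n ↦ connectedComponentIn (D n) x₀ with hW
  have hWopen : ∀ n, IsOpen (W n) := fun n ↦ (hDopen n).connectedComponentIn
  have hWD : ∀ n, W n ⊆ D n := fun n ↦ connectedComponentIn_subset _ _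
  have hWmono : Monotone W := fun m n hmn ↦ connectedComponentIn_mono _ (hDmono hmn)
  have hx₀W : ∀ n z, z ∈ W n → x₀ ∈ W n := fun n z hz ↦
    mem_connectedComponentIn (connectedComponentIn_nonempty_iff.1 ⟨z, hz⟩)
  have hcover : ∀ z ∈ V, ∃ n, z ∈ W n := by
    intro z hz
    obtain ⟨p, hp⟩ := ((hV.isOpen.isConnected_iff_isPathConnected).1
      ⟨⟨x₀, hx₀⟩, hV.isPreconnected⟩).joinedIn x₀ hx₀ z hz
    have hcomp : IsCompact (range p) := isCompact_range p.continuous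
    obtain ⟨y, hy, hmin⟩ := hcomp.exists_isMinOn (range_nonempty p)
      (continuous_infDist_pt Vᶜ).continuousOn
    have hpos : 0 < infDist y Vᶜ := by
      rw [← hV.isOpen.isClosed_compl.notMem_iff_infDist_pos hne]
      obtain ⟨t, rfl⟩ := hy
      exact fun h ↦ h (hp t)
    obtain ⟨n, hn⟩ := exists_nat_one_div_lt hpos
    have hsub : range p ⊆ D n := fun w hw ↦ hn.trans_le (hmin hw)
    exact ⟨n, (isPreconnected_range p.continuous).subset_connectedComponentIn
      ⟨0, p.source⟩ hsub ⟨1, p.target⟩⟩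
  have hroot : ∀ n, ∃ s : ℂ → ℂ, ContinuousOn s (W n) ∧ (∀ z ∈ W n, s z ^ 2 = z) ∧
      (x₀ ∈ W n → s x₀ = Complex.exp (Complex.log x₀ / 2)) := by
    intro n
    obtain ⟨s, hs, hs2⟩ := hV.exists_sqrt_of_lt_infDist h0 (δ := 1 / ((n : ℝ) + 1)) (by positivity)
      ((hWD n).trans (hDV n)) (fun z hz ↦ hWD n hz)
    have hc : (Complex.exp (Complex.log x₀ / 2)) ^ 2 = x₀ := by
      rw [← Complex.exp_nat_mul]
      push_cast
      rw [mul_div_cancel₀ _ two_ne_zero, Complex.exp_log (ne_of_mem_of_not_mem hx₀ h0)]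
    by_cases hx : x₀ ∈ W n
    · rcases sq_eq_sq_iff_eq_or_eq_neg.1 ((hs2 _ hx).trans hc.symm) with h | h
      · exact ⟨s, hs, hs2, fun _ ↦ h⟩
      · exact ⟨fun z ↦ -s z, hs.neg, fun z hz ↦ by rw [neg_sq, hs2 z hz], fun _ ↦ by simp [h]⟩
    · exact ⟨s, hs, hs2, fun h ↦ absurd h hx⟩
  choose s hs hs2 hs0 using hroot
  have hagree : ∀ m n, m ≤ n → EqOn (s m) (s n) (W m) := by
    intro m n hmn z hz
    have hx := hx₀W m z hz
    exact IsPreconnected.eq_of_sq_eq isPreconnected_connectedComponentIn (hs m)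
      ((hs n).mono (hWmono hmn)) (fun w hw ↦ by
        simp only [Pi.pow_apply]
        rw [hs2 m w hw, hs2 n w (hWmono hmn hw)])
      (fun {w} hw h ↦ by
        have := hs2 n w (hWmono hmn hw)
        rw [h] at this
        have hw0 : w = 0 := by simpa using this.symm
        exact h0 (hw0 ▸ hDV m (hWD m hw))) hx
      (by rw [hs0 m hx, hs0 n (hWmono hmn hx)]) hz
  choose! N hN using hcover
  have hglue : ∀ n, EqOn (fun z ↦ s (N z) z) (s n) (W n) := by
    intro n z hz
    have hzV := hDV n (hWD n hz)
    rcases le_total (N z) n with h | h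
    · exact hagree _ _ h (hN z hzV)
    · exact (hagree _ _ h hz).symm
  refine ⟨fun z ↦ s (N z) z, fun z hz ↦ ?_, fun z hz ↦ hs2 _ _ (hN z hz)⟩
  have hnhds : W (N z) ∈ nhds z := (hWopen _).mem_nhds (hN z hz)
  exact ((((hs (N z)).congr (hglue (N z))).continuousAt hnhds)).continuousWithinAt

/-- This makes `s '' V` and its negative disjoint when `V` omits 0. -/
theorem IsDiscDomain.zero_mem_of_eq_neg {V : Set ℂ} {s : ℂ → ℂ} (hs : ∀ z ∈ V, s z ^ 2 = z)
    {z w : ℂ} (hz : z ∈ V) (hw : w ∈ V) (h : s z = -s w) : (0 : ℂ) ∈ V := by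
  have h1 : z = w := by rw [← hs z hz, ← hs w hw, h, neg_sq]
  subst h1
  have h2 : s z = 0 := by linear_combination h / 2
  have := hs z hz
  rw [h2] at this
  have h3 : z = 0 := by simpa using this.symm
  exact h3 ▸ hz

/-- The image of a disc domain that omits `0` under a branch of the square root. -/
theorem IsDiscDomain.image_sqrt {V : Set ℂ} (hV : IsDiscDomain V) (h0 : 0 ∉ V) {s : ℂ → ℂ}
    (hs : ContinuousOn s V) (hs2 : ∀ z ∈ V, s z ^ 2 = z) (hopen : IsOpen (s '' V)) :
    IsDiscDomain (s '' V) := by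
  rcases V.eq_empty_or_nonempty with rfl | ⟨z₀, hz₀⟩
  · simpa using hV
  have hsub : s '' V ⊆ ball 0 1 := by
    rintro _ ⟨z, hz, rfl⟩
    have h1 := hV.subset_ball hz
    rw [mem_ball_zero_iff] at h1 ⊢
    rw [← hs2 z hz, norm_pow] at h1
    exact (pow_lt_one_iff_of_nonneg (norm_nonneg _) two_ne_zero).1 h1
  refine ⟨hopen, hV.isPreconnected.image s hs, hsub, ?_⟩
  set E : Set ℂ := (fun z : ℂ ↦ z ^ 2) ⁻¹' (closedBall 0 1 \ V) with hE
  have hEc : IsPreconnected E := isPreconnected_preimage_sq hV.isPreconnected_compl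
    ((isCompact_closedBall _ _).diff hV.isOpen) ⟨by simp, h0⟩
  have hball : ∀ w : ℂ, w ^ 2 ∈ closedBall (0 : ℂ) 1 ↔ w ∈ closedBall (0 : ℂ) 1 := fun w ↦ by
    simp only [mem_closedBall_zero_iff, norm_pow]
    exact pow_le_one_iff_of_nonneg (norm_nonneg _) two_ne_zero
  -- The complement of `s '' V` in the closed disc consists of the connected set `E` and the open
  -- set of the negatives of `s '' V`.
  refine isPreconnected_of_isOpen_inter_subset (S := closedBall 0 1) (O := Neg.neg '' (s '' V))
    (E := E) (convex_closedBall _ _).isPreconnected ((isCompact_closedBall _ _).diff hopen).isClosed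
    ?_ hEc ?_ ((Homeomorph.neg ℂ).isOpenMap _ hopen) ?_ ?_ sdiff_subset
  · intro h
    exact (h (ball_subset_closedBall (hsub ⟨z₀, hz₀, rfl⟩))).2 ⟨z₀, hz₀, rfl⟩
  · rintro w ⟨hw1, hw2⟩
    refine ⟨(hball w).1 hw1, ?_⟩
    rintro ⟨z, hz, rfl⟩
    rw [show (fun z : ℂ ↦ z ^ 2) (s z) = z from hs2 z hz] at hw2
    exact hw2 hz
  · rintro _ ⟨⟨_, ⟨z, hz, rfl⟩, rfl⟩, hw⟩
    refine ⟨hw, ?_⟩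
    rintro ⟨z', hz', h⟩
    exact h0 (IsDiscDomain.zero_mem_of_eq_neg hs2 hz' hz h)
  · rintro w ⟨hw1, hw2⟩
    by_cases hwV : w ^ 2 ∈ V
    · rcases sq_eq_sq_iff_eq_or_eq_neg.1 (hs2 _ hwV) with h | h
      · exact absurd ⟨_, hwV, h⟩ hw2
      · exact Or.inr ⟨_, ⟨_, hwV, rfl⟩, by simp [h]⟩
    · exact Or.inl ⟨(hball w).2 hw1, hwV⟩

/-! ### Moebius transformations of the disc -/

/-- The Moebius transformation of the unit disc that takes `a` to `0`. -/
noncomputable def discMoebius (a z : ℂ) : ℂ := (z - a) / (1 - starRingEnd ℂ a * z)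

section Moebius

variable {a z : ℂ}

theorem one_sub_conj_mul_ne_zero (ha : ‖a‖ < 1) (hz : ‖z‖ ≤ 1) : 1 - starRingEnd ℂ a * z ≠ 0 := by
  intro h
  have h1 : ‖starRingEnd ℂ a * z‖ = 1 := by rw [← sub_eq_zero.1 h, norm_one]
  rw [norm_mul, Complex.norm_conj] at h1
  nlinarith [norm_nonneg a, norm_nonneg z]

theorem one_sub_normSq_discMoebius (ha : ‖a‖ < 1) (hz : ‖z‖ ≤ 1) :
    1 - ‖discMoebius a z‖ ^ 2 = (1 - ‖a‖ ^ 2) * (1 - ‖z‖ ^ 2) / ‖1 - starRingEnd ℂ a * z‖ ^ 2 := by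
  have h : ‖1 - starRingEnd ℂ a * z‖ ^ 2 ≠ 0 := by
    simpa using one_sub_conj_mul_ne_zero ha hz
  rw [discMoebius, norm_div, div_pow, eq_div_iff h, sub_mul, div_mul_cancel₀ _ h]
  simp only [← Complex.normSq_eq_norm_sq, Complex.normSq_apply, Complex.sub_re, Complex.sub_im,
    Complex.mul_re, Complex.mul_im, Complex.conj_re, Complex.conj_im, Complex.one_re,
    Complex.one_im]
  ring

theorem norm_discMoebius_le_one (ha : ‖a‖ < 1) (hz : ‖z‖ ≤ 1) : ‖discMoebius a z‖ ≤ 1 := by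
  have h := one_sub_normSq_discMoebius ha hz
  have h2 : 0 ≤ (1 - ‖a‖ ^ 2) * (1 - ‖z‖ ^ 2) / ‖1 - starRingEnd ℂ a * z‖ ^ 2 := by
    have : 0 ≤ 1 - ‖a‖ ^ 2 := by nlinarith [norm_nonneg a]
    have : 0 ≤ 1 - ‖z‖ ^ 2 := by nlinarith [norm_nonneg z]
    positivity
  nlinarith [norm_nonneg (discMoebius a z)]

theorem norm_discMoebius_lt_one (ha : ‖a‖ < 1) (hz : ‖z‖ < 1) : ‖discMoebius a z‖ < 1 := by
  have h := one_sub_normSq_discMoebius ha hz.le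
  have h2 : 0 < (1 - ‖a‖ ^ 2) * (1 - ‖z‖ ^ 2) / ‖1 - starRingEnd ℂ a * z‖ ^ 2 := by
    have h1 : 0 < 1 - ‖a‖ ^ 2 := by nlinarith [norm_nonneg a]
    have h2 : 0 < 1 - ‖z‖ ^ 2 := by nlinarith [norm_nonneg z]
    have h3 := norm_pos_iff.2 (one_sub_conj_mul_ne_zero ha hz.le)
    positivity
  nlinarith [norm_nonneg (discMoebius a z)]

theorem discMoebius_neg_discMoebius (ha : ‖a‖ < 1) (hz : ‖z‖ ≤ 1) :
    discMoebius (-a) (discMoebius a z) = z := by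
  have h1 := one_sub_conj_mul_ne_zero ha hz
  have h2 := one_sub_conj_mul_ne_zero ha ha.le
  rw [discMoebius, map_neg, neg_mul, sub_neg_eq_add, sub_neg_eq_add, discMoebius, div_eq_iff]
  · have h3 := div_mul_cancel₀ (z - a) h1
    refine mul_right_cancel₀ h1 ?_
    linear_combination (1 - z * starRingEnd ℂ a) * h3
  · have : 1 + starRingEnd ℂ a * ((z - a) / (1 - starRingEnd ℂ a * z)) =
        (1 - starRingEnd ℂ a * a) / (1 - starRingEnd ℂ a * z) := by
      field_simp
      ring
    rw [this]
    exact div_ne_zero h2 h1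

theorem discMoebius_discMoebius_neg (ha : ‖a‖ < 1) (hz : ‖z‖ ≤ 1) :
    discMoebius a (discMoebius (-a) z) = z := by
  simpa using discMoebius_neg_discMoebius (a := -a) (by simpa using ha) hz

theorem hasDerivAt_discMoebius (ha : ‖a‖ < 1) (hz : ‖z‖ ≤ 1) :
    HasDerivAt (discMoebius a) ((1 - starRingEnd ℂ a * a) / (1 - starRingEnd ℂ a * z) ^ 2) z := by
  have h1 := one_sub_conj_mul_ne_zero ha hz
  have := ((hasDerivAt_id z).sub_const a).div
    (((hasDerivAt_id z).const_mul (starRingEnd ℂ a)).const_sub 1) h1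
  refine this.congr_deriv ?_
  simp only [id]
  congr 1
  ring

theorem image_discMoebius_closedBall (ha : ‖a‖ < 1) :
    discMoebius a '' closedBall 0 1 = closedBall 0 1 := by
  refine Subset.antisymm ?_ fun z hz ↦ ?_
  · rintro _ ⟨z, hz, rfl⟩
    rw [mem_closedBall_zero_iff] at hz ⊢
    exact norm_discMoebius_le_one ha hz
  · rw [mem_closedBall_zero_iff] at hz
    exact ⟨discMoebius (-a) z, mem_closedBall_zero_iff.2
      (norm_discMoebius_le_one (by simpa using ha) hz), discMoebius_discMoebius_neg ha hz⟩

theorem injOn_discMoebius (ha : ‖a‖ < 1) : InjOn (discMoebius a) (closedBall 0 1) := by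
  intro z hz w hw h
  rw [mem_closedBall_zero_iff] at hz hw
  rw [← discMoebius_neg_discMoebius ha hz, h, discMoebius_neg_discMoebius ha hw]

theorem IsDiscDomain.image_discMoebius {V : Set ℂ} (hV : IsDiscDomain V) (ha : ‖a‖ < 1) :
    IsDiscDomain (discMoebius a '' V) := by
  have hcont : ContinuousOn (discMoebius a) (closedBall 0 1) := fun z hz ↦
    (hasDerivAt_discMoebius ha (by simpa using hz)).continuousAt.continuousWithinAt
  have hVS : V ⊆ closedBall 0 1 := hV.subset_ball.trans ball_subset_closedBall
  have hsub : discMoebius a '' V ⊆ ball 0 1 := by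
    rintro _ ⟨z, hz, rfl⟩
    rw [mem_ball_zero_iff]
    exact norm_discMoebius_lt_one ha (by simpa using hV.subset_ball hz)
  refine ⟨?_, hV.isPreconnected.image _ (hcont.mono hVS), hsub, ?_⟩
  · have ha' : ‖-a‖ < 1 := by simpa using ha
    have : discMoebius a '' V = ball 0 1 ∩ discMoebius (-a) ⁻¹' V := by
      refine Subset.antisymm ?_ ?_
      · rintro _ ⟨z, hz, rfl⟩
        refine ⟨hsub ⟨z, hz, rfl⟩, ?_⟩
        rw [mem_preimage, discMoebius_neg_discMoebius ha (by simpa using hVS hz)]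
        exact hz
      · rintro w ⟨hw, hwV⟩
        rw [mem_ball_zero_iff] at hw
        exact ⟨_, hwV, discMoebius_discMoebius_neg ha hw.le⟩
    rw [this]
    refine ContinuousOn.isOpen_inter_preimage (fun w hw ↦ ?_) isOpen_ball hV.isOpen
    rw [mem_ball_zero_iff] at hw
    exact (hasDerivAt_discMoebius ha' hw.le).continuousAt.continuousWithinAt
  · rw [← image_discMoebius_closedBall ha, ← (injOn_discMoebius ha).image_sdiff_subset hVS]
    exact hV.isPreconnected_compl.image _ (hcont.mono sdiff_subset)

end Moebius

/-! ### Injective holomorphic functions and their inverses -/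

section Univalent

variable {U : Set ℂ} {f g : ℂ → ℂ} {z₀ : ℂ}

theorem not_eventually_eq_of_injOn (hU : IsOpen U) (hinj : InjOn f U) (hz₀ : z₀ ∈ U) :
    ¬ ∀ᶠ z in nhds z₀, f z = f z₀ := by
  intro h
  have h1 : ∀ᶠ z in nhdsWithin z₀ {z₀}ᶜ, z = z₀ := by
    filter_upwards [h.filter_mono nhdsWithin_le_nhds,
      mem_nhdsWithin_of_mem_nhds (hU.mem_nhds hz₀)] with z hz hzU
    exact hinj hzU hz₀ hz
  obtain ⟨z, hz, hz'⟩ := (h1.and self_mem_nhdsWithin).exists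
  exact hz' hz

theorem nhds_le_map_nhds_of_injOn (hU : IsOpen U) (hf : DifferentiableOn ℂ f U) (hinj : InjOn f U)
    (hz₀ : z₀ ∈ U) : nhds (f z₀) ≤ Filter.map f (nhds z₀) :=
  (hf.analyticAt (hU.mem_nhds hz₀)).eventually_constant_or_nhds_le_map_nhds.resolve_left
    (not_eventually_eq_of_injOn hU hinj hz₀)

theorem image_mem_nhds_of_injOn (hU : IsOpen U) (hf : DifferentiableOn ℂ f U) (hinj : InjOn f U)
    (hz₀ : z₀ ∈ U) : f '' U ∈ nhds (f z₀) :=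
  nhds_le_map_nhds_of_injOn hU hf hinj hz₀ (Filter.image_mem_map (hU.mem_nhds hz₀))

theorem isOpen_image_of_injOn (hU : IsOpen U) (hf : DifferentiableOn ℂ f U) (hinj : InjOn f U) :
    IsOpen (f '' U) := by
  rw [isOpen_iff_mem_nhds]
  rintro _ ⟨z, hz, rfl⟩
  exact image_mem_nhds_of_injOn hU hf hinj hz

theorem continuousAt_leftInvOn (hU : IsOpen U) (hf : DifferentiableOn ℂ f U)
    (hg : LeftInvOn g f U) (hz₀ : z₀ ∈ U) : ContinuousAt g (f z₀) := by
  rw [ContinuousAt, hg hz₀]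
  refine (Filter.tendsto_map'_iff.2 ?_ : Filter.Tendsto g (Filter.map f (nhds z₀)) _).mono_left
    (nhds_le_map_nhds_of_injOn hU hf hg.injOn hz₀)
  refine Filter.tendsto_id.congr' ?_
  filter_upwards [hU.mem_nhds hz₀] with z hz
  exact (hg hz).symm

/-- The inverse of an injective holomorphic function is holomorphic. -/
theorem differentiableAt_leftInvOn (hU : IsOpen U) (hf : DifferentiableOn ℂ f U)
    (hg : LeftInvOn g f U) (hz₀ : z₀ ∈ U) : DifferentiableAt ℂ g (f z₀) := by
  have hinj := hg.injOn
  have han : AnalyticAt ℂ (deriv f) z₀ := (hf.analyticAt (hU.mem_nhds hz₀)).deriv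
  have hne : ∀ᶠ z in nhdsWithin z₀ {z₀}ᶜ, deriv f z ≠ 0 := by
    refine han.eventually_eq_zero_or_eventually_ne_zero.resolve_left fun h ↦ ?_
    obtain ⟨ε, hε, hball⟩ := Metric.eventually_nhds_iff_ball.1 (h.and (hU.mem_nhds hz₀))
    refine not_eventually_eq_of_injOn hU hinj hz₀ ?_
    filter_upwards [ball_mem_nhds z₀ hε] with z hz
    exact isOpen_ball.is_const_of_deriv_eq_zero (convex_ball z₀ ε).isPreconnected
      (hf.mono fun w hw ↦ (hball w hw).2) (fun w hw ↦ (hball w hw).1) hz (mem_ball_self hε)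
  have hcont := continuousAt_leftInvOn hU hf hg hz₀
  have h1 : ∀ᶠ w in nhds (f z₀), w ≠ f z₀ → deriv f (g w) ≠ 0 := by
    have h2 : ∀ᶠ z in nhds z₀, z ≠ z₀ → deriv f z ≠ 0 := eventually_nhdsWithin_iff.1 hne
    rw [ContinuousAt, hg hz₀] at hcont
    filter_upwards [hcont.eventually h2, image_mem_nhds_of_injOn hU hf hinj hz₀]
    rintro _ h3 ⟨z, hz, rfl⟩ hw
    rw [hg hz] at h3 ⊢
    exact h3 fun h ↦ hw (h ▸ rfl)
  have himg := image_mem_nhds_of_injOn hU hf hinj hz₀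
  set s : Set ℂ := {w | w ∈ f '' U ∧ (w ≠ f z₀ → deriv f (g w) ≠ 0)} with hs
  have hsn : s ∈ nhds (f z₀) := Filter.inter_mem himg h1
  -- Zeros of `deriv f` are isolated, so `g` is differentiable near `f z₀` except perhaps at `f z₀`,
  -- where it is continuous: the singularity is removable.
  refine ((Complex.differentiableOn_compl_singleton_and_continuousAt_iff hsn).1 ⟨?_, hcont⟩).differentiableAt
    hsn
  rintro _ ⟨⟨⟨z, hz, rfl⟩, hw⟩, hwne⟩
  have hgz := hg hz
  have hd : HasDerivAt f (deriv f z) (g (f z)) := by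
    rw [hgz]
    exact (hf.differentiableAt (hU.mem_nhds hz)).hasDerivAt
  have hw' := hw hwne
  rw [hgz] at hw'
  refine (HasDerivAt.of_local_left_inverse (continuousAt_leftInvOn hU hf hg hz) hd hw'
    ?_).differentiableAt.differentiableWithinAt
  filter_upwards [image_mem_nhds_of_injOn hU hf hinj hz]
  rintro _ ⟨y, hy, rfl⟩
  rw [hg hy]

theorem deriv_leftInvOn_mul_deriv (hU : IsOpen U) (hf : DifferentiableOn ℂ f U)
    (hg : LeftInvOn g f U) (hz₀ : z₀ ∈ U) : deriv g (f z₀) * deriv f z₀ = 1 := by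
  have h1 := (differentiableAt_leftInvOn hU hf hg hz₀).hasDerivAt.comp z₀
    (hf.differentiableAt (hU.mem_nhds hz₀)).hasDerivAt
  refine h1.unique ((hasDerivAt_id z₀).congr_of_eventuallyEq ?_)
  filter_upwards [hU.mem_nhds hz₀] with z hz
  exact hg hz

end Univalent

/-! ### Koebe's transformation and the Riemann mapping theorem -/

/-- `f` is a conformal map of `U` onto a disc domain that fixes `0`. -/
structure IsDiscEmbedding (U : Set ℂ) (f : ℂ → ℂ) : Prop where
  differentiableOn : DifferentiableOn ℂ f U
  injOn : InjOn f U
  map_zero : f 0 = 0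
  image : IsDiscDomain (f '' U)

/-- With t = |b| and t² = |a|, the right side is the factor that Koebe's transformation applies to
|f'(0)|. It equals (1 + t²)/(2t) = 1 + (1 - t)²/(2t). -/
theorem one_add_le_koebe_factor {t ρ : ℝ} (ht : 0 < t) (htρ : t ≤ ρ) (hρ : ρ < 1) :
    1 + (1 - ρ) ^ 2 / 2 ≤ (1 - (t ^ 2) ^ 2) * ((2 * t)⁻¹ * (1 - t ^ 2)⁻¹) := by
  have h1 : 1 - t ^ 2 ≠ 0 := by nlinarith
  have h2 : (1 - (t ^ 2) ^ 2) * ((2 * t)⁻¹ * (1 - t ^ 2)⁻¹) = (1 + t ^ 2) / (2 * t) := by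
    field_simp
    ring
  rw [h2, le_div_iff₀ (by positivity)]
  nlinarith [mul_nonneg ht.le (sq_nonneg (1 - ρ)), sq_nonneg (1 - t),
    mul_nonneg (sub_nonneg.2 htρ) (sub_nonneg.2 hρ.le), mul_pos ht (sub_pos.2 hρ),
    mul_nonneg (sub_nonneg.2 (htρ.trans hρ.le)) (sq_nonneg (1 - t))]

/-- Koebe's square root transformation: a conformal map onto a disc domain that omits a point of
the disc can be replaced by one with a larger derivative. -/
theorem IsDiscEmbedding.exists_koebe {U : Set ℂ} (hU : IsOpen U) (h0 : 0 ∈ U) {f : ℂ → ℂ}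
    (hf : IsDiscEmbedding U f) {a : ℂ} (ha : a ∉ f '' U) {ρ : ℝ} (hρ0 : 0 < ρ) (hρ1 : ρ < 1)
    (haρ : ‖a‖ < ρ ^ 2) :
    ∃ F : ℂ → ℂ, IsDiscEmbedding U F ∧ ‖deriv f 0‖ * (1 + (1 - ρ) ^ 2 / 2) ≤ ‖deriv F 0‖ := by
  have ha1 : ‖a‖ < 1 := haρ.trans (by nlinarith)
  have hfU : f '' U ⊆ closedBall 0 1 := hf.image.subset_ball.trans ball_subset_closedBall
  have hV := hf.image.image_discMoebius ha1
  have h0V : (0 : ℂ) ∉ discMoebius a '' (f '' U) := by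
    rintro ⟨w, hw, h⟩
    have := discMoebius_neg_discMoebius ha1 (by simpa using hfU hw)
    rw [h] at this
    apply ha
    rw [← this] at hw
    simpa [discMoebius] using hw
  set V := discMoebius a '' (f '' U) with hVdef
  obtain ⟨s, hs, hs2⟩ := hV.exists_sqrt h0V
  have hne : ∀ v ∈ V, s v ≠ 0 := fun v hv h ↦ by
    have := hs2 v hv
    rw [h] at this
    have h3 : v = 0 := by simpa using this.symm
    exact h0V (h3 ▸ hv)
  have hsd : ∀ v ∈ V, HasDerivAt s (2 * s v)⁻¹ v := fun v hv ↦ by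
    refine HasDerivAt.of_local_left_inverse (f := fun z ↦ z ^ 2)
      (hs.continuousAt (hV.isOpen.mem_nhds hv)) ?_ (mul_ne_zero two_ne_zero (hne v hv)) ?_
    · simpa using hasDerivAt_pow 2 (s v)
    · filter_upwards [hV.isOpen.mem_nhds hv] with y hy
      exact hs2 y hy
  have hsinj : InjOn s V := fun v hv w hw h ↦ by rw [← hs2 v hv, h, hs2 w hw]
  have hW := hV.image_sqrt h0V hs hs2 (isOpen_image_of_injOn hV.isOpen
    (fun v hv ↦ (hsd v hv).differentiableAt.differentiableWithinAt) hsinj)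
  have hV0 : -a ∈ V := ⟨0, ⟨0, h0, hf.map_zero⟩, by simp [discMoebius]⟩
  set b := s (-a) with hb
  have hb2 : ‖b‖ ^ 2 = ‖a‖ := by rw [← norm_pow, hs2 _ hV0, norm_neg]
  have hb1 : ‖b‖ < 1 := by
    have := hW.subset_ball ⟨_, hV0, rfl⟩
    simpa using this
  have hbpos : 0 < ‖b‖ := norm_pos_iff.2 (hne _ hV0)
  have hbρ : ‖b‖ ≤ ρ := by
    by_contra! h
    nlinarith
  have hWS : s '' V ⊆ closedBall 0 1 := hW.subset_ball.trans ball_subset_closedBall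
  have hm1 : MapsTo (fun z ↦ discMoebius a (f z)) U V := fun z hz ↦ ⟨_, ⟨_, hz, rfl⟩, rfl⟩
  have hd : ∀ z ∈ U, HasDerivAt (fun z ↦ discMoebius b (s (discMoebius a (f z))))
      ((1 - starRingEnd ℂ b * b) / (1 - starRingEnd ℂ b * s (discMoebius a (f z))) ^ 2 *
        ((2 * s (discMoebius a (f z)))⁻¹ * ((1 - starRingEnd ℂ a * a) /
          (1 - starRingEnd ℂ a * f z) ^ 2 * deriv f z))) z := fun z hz ↦ by
    have e1 := (hasDerivAt_discMoebius ha1 (by simpa using hfU ⟨z, hz, rfl⟩)).comp z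
      (hf.differentiableOn.differentiableAt (hU.mem_nhds hz)).hasDerivAt
    have e2 := (hsd _ (hm1 hz)).comp z e1
    exact (hasDerivAt_discMoebius hb1 (by simpa using hWS ⟨_, hm1 hz, rfl⟩)).comp z e2
  -- The first Moebius map moves the omitted point `a` to 0, so that a root exists; the second
  -- brings the image `b` of the base point back to 0.
  refine ⟨fun z ↦ discMoebius b (s (discMoebius a (f z))),
    ⟨fun z hz ↦ (hd z hz).differentiableAt.differentiableWithinAt, ?_, ?_, ?_⟩, ?_⟩
  · intro z hz w hw h
    refine hf.injOn hz hw (injOn_discMoebius ha1 (hfU ⟨z, hz, rfl⟩) (hfU ⟨w, hw, rfl⟩)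
      (hsinj (hm1 hz) (hm1 hw) (injOn_discMoebius hb1 (hWS ⟨_, hm1 hz, rfl⟩)
        (hWS ⟨_, hm1 hw, rfl⟩) h)))
  · simp [hf.map_zero, discMoebius, hb]
  · have := hW.image_discMoebius hb1
    rwa [hVdef, image_image, image_image, image_image] at this
  · have e0 : discMoebius a 0 = -a := by simp [discMoebius]
    have key : ∀ c : ℂ, ‖c‖ < 1 → ‖1 - starRingEnd ℂ c * c‖ = 1 - ‖c‖ ^ 2 := fun c hc ↦ by
      rw [← Complex.normSq_eq_conj_mul_self, Complex.normSq_eq_norm_sq, ← Complex.ofReal_one,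
        ← Complex.ofReal_sub, Complex.norm_real, Real.norm_of_nonneg]
      nlinarith [norm_nonneg c]
    rw [(hd 0 h0).deriv, hf.map_zero, e0, ← hb]
    simp only [norm_mul, norm_div, norm_inv, norm_pow, key a ha1, key b hb1, mul_zero, sub_zero,
      one_pow, div_one, Complex.norm_ofNat]
    have hbb : 1 - ‖b‖ ^ 2 ≠ 0 := by nlinarith
    calc ‖deriv f 0‖ * (1 + (1 - ρ) ^ 2 / 2)
        ≤ ‖deriv f 0‖ * ((1 - (‖b‖ ^ 2) ^ 2) * ((2 * ‖b‖)⁻¹ * (1 - ‖b‖ ^ 2)⁻¹)) :=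
          mul_le_mul_of_nonneg_left (one_add_le_koebe_factor hbpos hbρ hρ1) (norm_nonneg _)
      _ = _ := by
        rw [← hb2]
        field_simp

/-- An embedding with nearly maximal |f'(0)| suffices: if it omitted a point of norm less than ρ²,
Koebe's transformation would exceed the supremum, which is finite by the Schwarz lemma. -/
theorem IsDiscDomain.exists_isDiscEmbedding {U : Set ℂ} (hU : IsDiscDomain U) (h0 : 0 ∈ U) {ρ : ℝ}
    (hρ0 : 0 < ρ) (hρ1 : ρ < 1) : ∃ f : ℂ → ℂ, IsDiscEmbedding U f ∧ ball 0 (ρ ^ 2) ⊆ f '' U := by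
  obtain ⟨ε, hε, hball⟩ := Metric.isOpen_iff.1 hU.isOpen 0 h0
  set A : Set ℝ := {x | ∃ f : ℂ → ℂ, IsDiscEmbedding U f ∧ ‖deriv f 0‖ = x} with hA
  have hbdd : BddAbove A := by
    refine ⟨1 / ε, ?_⟩
    rintro _ ⟨f, hf, rfl⟩
    refine Complex.norm_deriv_le_div_of_mapsTo_ball (hf.differentiableOn.mono hball) ?_ hε
    rw [hf.map_zero]
    exact fun z hz ↦ ball_subset_closedBall (hf.image.subset_ball ⟨z, hball hz, rfl⟩)
  have h1 : (1 : ℝ) ∈ A := ⟨id, ⟨differentiableOn_id, injOn_id _, rfl, by simpa using hU⟩, by simp⟩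
  have hM : 0 < sSup A := zero_lt_one.trans_le (le_csSup hbdd h1)
  have hk : 1 < 1 + (1 - ρ) ^ 2 / 2 := by nlinarith [sq_pos_of_pos (sub_pos.2 hρ1)]
  obtain ⟨_, ⟨f, hf, rfl⟩, hlt⟩ := exists_lt_of_lt_csSup ⟨_, h1⟩ (div_lt_self hM hk)
  refine ⟨f, hf, fun a ha ↦ ?_⟩
  by_contra haf
  obtain ⟨F, hF, hle⟩ := hf.exists_koebe hU.isOpen h0 haf hρ0 hρ1 (by simpa using ha)
  rw [div_lt_iff₀ (by positivity)] at hlt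
  exact (hlt.trans_le hle).not_ge (le_csSup hbdd ⟨F, hF, rfl⟩)

/-- Montel's theorem: along an ultrafilter, a bounded family of holomorphic functions converges
locally uniformly. -/
theorem exists_tendstoLocallyUniformlyOn {ι : Type*} (l : Ultrafilter ι) {U : Set ℂ}
    (hU : IsOpen U) {F : ι → ℂ → ℂ} (hF : ∀ i, DifferentiableOn ℂ (F i) U)
    (hF1 : ∀ i, MapsTo (F i) U (ball 0 1)) :
    ∃ f : ℂ → ℂ, TendstoLocallyUniformlyOn F f l U := by
  have hlim : ∀ z ∈ U, ∃ w, Filter.Tendsto (fun i ↦ F i z) l (nhds w) := fun z hz ↦ by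
    obtain ⟨w, -, hw⟩ := (isCompact_closedBall (0 : ℂ) 1).ultrafilter_le_nhds
      (l.map fun i ↦ F i z) (by
        rw [Filter.le_principal_iff]
        exact Filter.mem_map.2 (Filter.univ_mem' fun i ↦ ball_subset_closedBall (hF1 i hz)))
    exact ⟨w, hw⟩
  choose! f hf using hlim
  refine ⟨f, Metric.tendstoLocallyUniformlyOn_iff.2 fun ε hε z₀ hz₀ ↦ ?_⟩
  obtain ⟨r, hr, hball⟩ := Metric.isOpen_iff.1 hU z₀ hz₀
  -- The Schwarz lemma gives a Lipschitz constant independent of `i`, which upgrades pointwise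
  -- convergence to locally uniform convergence.
  have hlip : ∀ i, ∀ z ∈ ball z₀ r, dist (F i z) (F i z₀) ≤ 2 / r * dist z z₀ := fun i z hz ↦ by
    refine Complex.dist_le_div_mul_dist_of_mapsTo_ball ((hF i).mono hball) (fun w hw ↦ ?_) hz
    have h1 := hF1 i (hball hw)
    have h2 := hF1 i hz₀
    rw [mem_ball] at h1 h2
    rw [mem_closedBall]
    calc dist (F i w) (F i z₀) ≤ dist (F i w) 0 + dist (F i z₀) 0 := dist_triangle_right _ _ _
      _ ≤ 2 := by linarith
  have hlip' : ∀ z ∈ ball z₀ r, dist (f z) (f z₀) ≤ 2 / r * dist z z₀ := fun z hz ↦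
    le_of_tendsto' ((hf z (hball hz)).dist (hf z₀ hz₀)) fun i ↦ hlip i z hz
  have hη : 0 < min r (ε * r / 8) := lt_min hr (by positivity)
  refine ⟨ball z₀ (min r (ε * r / 8)), mem_nhdsWithin_of_mem_nhds (ball_mem_nhds _ hη), ?_⟩
  filter_upwards [(Metric.tendsto_nhds.1 (hf z₀ hz₀)) (ε / 2) (half_pos hε)] with i hi z hz
  have hzr : z ∈ ball z₀ r := ball_subset_ball (min_le_left _ _) hz
  have h4 : 2 / r * dist z z₀ ≤ ε / 4 := by
    have h5 : dist z z₀ ≤ ε * r / 8 := (mem_ball.1 hz).le.trans (min_le_right _ _)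
    calc 2 / r * dist z z₀ ≤ 2 / r * (ε * r / 8) := by gcongr
      _ = ε / 4 := by field_simp; ring
  have h6 := hlip i z hzr
  have h7 := hlip' z hzr
  calc dist (f z) (F i z) ≤ dist (f z) (f z₀) + dist (f z₀) (F i z₀) + dist (F i z₀) (F i z) :=
        dist_triangle4 _ _ _ _
    _ < ε := by
      rw [dist_comm (f z₀) (F i z₀), dist_comm (F i z₀) (F i z)]
      linarith

/-- Hurwitz's theorem: if holomorphic injective functions with values in `U` converge locally
uniformly to a nonconstant function, then the limit has values in `U`. -/
theorem mem_of_tendstoLocallyUniformlyOn {ι : Type*} {l : Filter ι} [l.NeBot] {U D : Set ℂ}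
    {G : ι → ℂ → ℂ} {g : ℂ → ℂ} (hD : IsOpen D) (hDc : IsPreconnected D)
    (hG : ∀ i, DifferentiableOn ℂ (G i) D) (hinj : ∀ i, InjOn (G i) D)
    (hGU : ∀ i, MapsTo (G i) D U) (hlim : TendstoLocallyUniformlyOn G g l D)
    (hne : ¬ ∀ z ∈ D, ∀ w ∈ D, g z = g w) {w : ℂ} (hw : w ∈ D) : g w ∈ U := by
  have hg : DifferentiableOn ℂ g D := hlim.differentiableOn (Filter.Eventually.of_forall hG) hD
  have hne' : ∀ᶠ z in nhdsWithin w {w}ᶜ, g z ≠ g w := by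
    refine ((hg.analyticAt (hD.mem_nhds hw)).eventually_eq_or_eventually_ne
      analyticAt_const).resolve_left fun h ↦ hne ?_
    have := (hg.analyticOnNhd hD).eqOn_of_preconnected_of_eventuallyEq
      (fun _ _ ↦ analyticAt_const) hDc hw h
    intro z hz y hy
    rw [this hz, this hy]
  obtain ⟨r, hr, hball⟩ : ∃ r > 0, ∀ z ∈ closedBall w r, (z ≠ w → g z ≠ g w) ∧ z ∈ D := by
    rw [eventually_nhdsWithin_iff] at hne'
    obtain ⟨r, hr, h⟩ := Metric.nhds_basis_closedBall.eventually_iff.1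
      (hne'.and (hD.mem_nhds hw))
    exact ⟨r, hr, fun z hz ↦ h hz⟩
  have hcD : closedBall w r ⊆ D := fun z hz ↦ (hball z hz).2
  have hsD : sphere w r ⊆ D := sphere_subset_closedBall.trans hcD
  obtain ⟨z₁, hz₁, hmin⟩ := (isCompact_sphere w r).exists_isMinOn
    (NormedSpace.sphere_nonempty.2 hr.le) (f := fun z ↦ ‖g z - g w‖)
    ((hg.continuousOn.mono hsD).sub continuousOn_const).norm
  set m := ‖g z₁ - g w‖ with hm
  have hmpos : 0 < m := norm_pos_iff.2 (sub_ne_zero.2 ((hball z₁ (sphere_subset_closedBall hz₁)).1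
    (ne_of_mem_sphere hz₁ hr.ne')))
  obtain ⟨i, hi⟩ := (Metric.tendstoUniformlyOn_iff.1
    ((tendstoLocallyUniformlyOn_iff_forall_isCompact hD).1 hlim _ hcD (isCompact_closedBall w r))
    (m / 4) (by positivity)).exists
  have hwi := hi w (mem_closedBall_self hr.le)
  -- On the circle `G i` stays at distance at least m/2 from `G i w`, so its image contains the ball
  -- of radius m/4 about `G i w`, and that ball contains `g w`.
  have hsub := DiffContOnCl.ball_subset_image_closedBall (f := G i) (z₀ := w) (r := r) (ε := m / 2)
    (((hG i).mono (by rwa [closure_ball w hr.ne'])).diffContOnCl) hr (fun z hz ↦ by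
      have h1 : m ≤ ‖g z - g w‖ := hmin hz
      have h2 := hi z (sphere_subset_closedBall hz)
      rw [dist_eq_norm] at h2 hwi
      have h3 : ‖g z - g w‖ ≤ ‖g z - G i z‖ + ‖G i z - G i w‖ + ‖g w - G i w‖ := by
        rw [norm_sub_rev (g w) (G i w)]
        calc ‖g z - g w‖ = ‖(g z - G i z) + (G i z - G i w) + (G i w - g w)‖ := by ring_nf
          _ ≤ _ := norm_add₃_le
      linarith)
    (Filter.not_eventually.1 (not_eventually_eq_of_injOn hD (hinj i) hw))
  obtain ⟨z, hz, hgz⟩ := hsub (show g w ∈ ball (G i w) (m / 2 / 2) by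
    rw [mem_ball]; linarith)
  exact hgz ▸ hGU i (hcD hz)

/-- The Riemann mapping theorem for disc domains. -/
theorem IsDiscDomain.exists_isNormalizedRiemannMap {U : Set ℂ} (hU : IsDiscDomain U)
    (h0 : 0 ∈ U) : ∃ φ : ℂ → ℂ, IsNormalizedRiemannMap U 0 φ := by
  have hUo := hU.isOpen
  have hρ : ∀ n : ℕ, 0 < 1 - 1 / ((n : ℝ) + 2) ∧ 1 - 1 / ((n : ℝ) + 2) < 1 := fun n ↦ by
    have h1 : 1 / ((n : ℝ) + 2) < 1 := by
      rw [div_lt_one (by positivity)]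
      have : (0 : ℝ) ≤ n := n.cast_nonneg
      linarith
    have h2 : 0 < 1 / ((n : ℝ) + 2) := by positivity
    exact ⟨by linarith, by linarith⟩
  choose F hF hFball using fun n : ℕ ↦ hU.exists_isDiscEmbedding h0 (hρ n).1 (hρ n).2
  set r : ℕ → ℝ := fun n ↦ (1 - 1 / ((n : ℝ) + 2)) ^ 2 with hr
  have hrpos : ∀ n, 0 < r n := fun n ↦ pow_pos (hρ n).1 2
  have hr1 : ∀ n, r n < 1 := fun n ↦ pow_lt_one₀ (hρ n).1.le (hρ n).2 two_ne_zero
  set l : Ultrafilter ℕ := Filter.hyperfilter ℕ with hl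
  have hrlim : Filter.Tendsto r l (nhds 1) := by
    have h1 : Filter.Tendsto (fun n : ℕ ↦ 1 / ((n : ℝ) + 2)) Filter.atTop (nhds 0) := by
      refine Filter.Tendsto.div_atTop tendsto_const_nhds
        (Filter.tendsto_atTop_add_const_right _ _ tendsto_natCast_atTop_atTop)
    have h2 := ((h1.const_sub 1).pow 2).mono_left Nat.hyperfilter_le_atTop
    simpa [hr] using h2
  have hrlim' : Filter.Tendsto (fun n ↦ (r n : ℂ)) l (nhds 1) := by
    simpa [Function.comp_def] using (Complex.continuous_ofReal.tendsto 1).comp hrlim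
  set k : ℕ → ℂ → ℂ := fun n ↦ Function.invFunOn (F n) U with hk
  have hkl : ∀ n, LeftInvOn (k n) (F n) U := fun n ↦ (hF n).injOn.leftInvOn_invFunOn
  -- The image of `F n` is only known to contain the disc of radius `r n`; rescaling defines every
  -- inverse on the whole unit disc.
  set G : ℕ → ℂ → ℂ := fun n w ↦ k n (r n * w) with hG
  have hscale : ∀ n, ∀ w ∈ ball (0 : ℂ) 1, (r n : ℂ) * w ∈ F n '' U := fun n w hw ↦ by
    refine hFball n ?_
    rw [mem_ball_zero_iff] at hw ⊢
    rw [norm_mul, Complex.norm_real, Real.norm_of_nonneg (hrpos n).le]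
    exact mul_lt_of_lt_one_right (hrpos n) hw
  have hGd : ∀ n, DifferentiableOn ℂ (G n) (ball 0 1) := fun n w hw ↦ by
    obtain ⟨z, hz, hzw⟩ := hscale n w hw
    have h1 := differentiableAt_leftInvOn hUo (hF n).differentiableOn (hkl n) hz
    rw [hzw] at h1
    exact (h1.comp w (by fun_prop)).differentiableWithinAt
  have hFG : ∀ n, ∀ w ∈ ball (0 : ℂ) 1, F n (G n w) = r n * w := fun n w hw ↦
    Function.invFunOn_eq (hscale n w hw)
  have hGU : ∀ n, MapsTo (G n) (ball 0 1) U := fun n w hw ↦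
    Function.invFunOn_mem (hscale n w hw)
  have hGinj : ∀ n, InjOn (G n) (ball 0 1) := fun n z hz w hw h ↦ by
    have h1 := hFG n z hz
    rw [h, hFG n w hw] at h1
    exact (mul_left_cancel₀ (Complex.ofReal_ne_zero.2 (hrpos n).ne') h1).symm
  have hF1 : ∀ n, MapsTo (F n) U (ball 0 1) := fun n z hz ↦ (hF n).image.subset_ball ⟨z, hz, rfl⟩
  obtain ⟨f, hf⟩ := exists_tendstoLocallyUniformlyOn l hUo (fun n ↦ (hF n).differentiableOn) hF1
  obtain ⟨g, hg⟩ := exists_tendstoLocallyUniformlyOn l isOpen_ball hGd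
    (fun n ↦ (hGU n).mono_right hU.subset_ball)
  have hfd : DifferentiableOn ℂ f U :=
    hf.differentiableOn (Filter.Eventually.of_forall fun n ↦ (hF n).differentiableOn) hUo
  have hgd : DifferentiableOn ℂ g (ball 0 1) :=
    hg.differentiableOn (Filter.Eventually.of_forall hGd) isOpen_ball
  have hf0 : f 0 = 0 := by
    refine tendsto_nhds_unique (hf.tendsto_at h0) ?_
    simp only [(hF _).map_zero]
    exact tendsto_const_nhds
  have hfle : ∀ z ∈ U, ‖f z‖ ≤ 1 := fun z hz ↦
    le_of_tendsto' (hf.tendsto_at hz).norm fun n ↦ (mem_ball_zero_iff.1 (hF1 n hz)).le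
  have hflt : MapsTo f U (ball 0 1) := by
    intro z hz
    rw [mem_ball_zero_iff]
    refine lt_of_le_of_ne (hfle z hz) fun h ↦ ?_
    have h1 := Complex.eqOn_of_isPreconnected_of_isMaxOn_norm hU.isPreconnected hUo hfd hz
      (fun w hw ↦ by simpa [h] using hfle w hw) h0
    rw [hf0] at h1
    have h2 : f z = 0 := h1.symm
    simp [h2] at h
  have hgf : LeftInvOn g f U := by
    intro z hz
    have h1 : Filter.Tendsto (fun n ↦ F n z / r n) l (nhds (f z)) := by
      simpa [Pi.div_def] using (hf.tendsto_at hz).div hrlim' one_ne_zero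
    have h2 := hg.tendsto_comp (hgd.continuousOn _ (hflt hz)) (hflt hz)
      (tendsto_nhdsWithin_iff.2 ⟨h1, h1.eventually (isOpen_ball.mem_nhds (hflt hz))⟩)
    refine tendsto_nhds_unique h2 (tendsto_const_nhds.congr fun n ↦ ?_)
    simp only [hG]
    rw [mul_div_cancel₀ _ (Complex.ofReal_ne_zero.2 (hrpos n).ne'), hkl n hz]
  have hgU : MapsTo g (ball 0 1) U := by
    intro w hw
    refine mem_of_tendstoLocallyUniformlyOn isOpen_ball (convex_ball _ _).isPreconnected hGd hGinj
      hGU hg (fun h ↦ ?_) hw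
    obtain ⟨ε, hε, hball⟩ := Metric.isOpen_iff.1 hUo 0 h0
    have hu : ((ε / 2 : ℝ) : ℂ) ∈ U := hball (by
      rw [mem_ball_zero_iff, Complex.norm_real, Real.norm_of_nonneg (by positivity)]
      linarith)
    have h1 := h _ (hflt h0) _ (hflt hu)
    rw [hgf h0, hgf hu] at h1
    exact (Complex.ofReal_ne_zero.2 (half_pos hε).ne') h1.symm
  have hfg : ∀ w ∈ ball (0 : ℂ) 1, f (g w) = w := by
    intro w hw
    have h1 := hg.tendsto_at hw
    have h2 := hf.tendsto_comp (hfd.continuousOn _ (hgU hw)) (hgU hw)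
      (tendsto_nhdsWithin_iff.2 ⟨h1, h1.eventually (hUo.mem_nhds (hgU hw))⟩)
    refine tendsto_nhds_unique h2 ?_
    simp only [hFG _ w hw]
    simpa using hrlim'.mul_const w
  have hder : deriv f 0 ≠ 0 := fun h ↦ by
    simpa [h] using deriv_leftInvOn_mul_deriv hUo hfd hgf h0
  -- The rotation that makes the derivative at 0 positive.
  set c : ℂ := starRingEnd ℂ (deriv f 0) / ‖deriv f 0‖ with hc
  have hnorm : (‖deriv f 0‖ : ℂ) ≠ 0 := by simpa using hder
  have hc1 : ‖c‖ = 1 := by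
    rw [hc, norm_div, Complex.norm_conj, Complex.norm_real, norm_norm,
      div_self (norm_ne_zero_iff.2 hder)]
  have hc0 : c ≠ 0 := norm_ne_zero_iff.1 (by rw [hc1]; exact one_ne_zero)
  have hcd : deriv (fun z ↦ c * f z) 0 = (‖deriv f 0‖ : ℝ) := by
    rw [deriv_const_mul _ (hfd.differentiableAt (hUo.mem_nhds h0)), hc, div_mul_eq_mul_div,
      ← Complex.normSq_eq_conj_mul_self, Complex.normSq_eq_norm_sq, div_eq_iff hnorm]
    push_cast
    ring
  refine ⟨fun z ↦ c * f z, hfd.const_mul c, ⟨fun z hz ↦ ?_, fun z hz w hw h ↦ ?_, fun w hw ↦ ?_⟩,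
    by simp [hf0], ?_, ?_⟩
  · have := hflt hz
    rw [mem_ball_zero_iff] at this ⊢
    simpa [hc1] using this
  · exact hgf.injOn hz hw (mul_left_cancel₀ hc0 h)
  · have hw' : w / c ∈ ball (0 : ℂ) 1 := by
      rw [mem_ball_zero_iff] at hw ⊢
      simpa [hc1] using hw
    exact ⟨g (w / c), hgU hw', by
      simp only [hfg _ hw']
      exact mul_div_cancel₀ w hc0⟩
  · rw [hcd, Complex.ofReal_re]
    exact norm_pos_iff.2 hder
  · rw [hcd, Complex.ofReal_im]

/-! ### Logarithmic area and the length-area inequality -/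

section Polar

open Real

theorem lintegral_eq_polar {F : ℂ → ℝ≥0∞} (hF : Measurable F) :
    ∫⁻ z, F z = ∫⁻ θ in Ioo (-π) π, ∫⁻ r in Ioi (0 : ℝ), ENNReal.ofReal r * F (circleMap 0 r θ) := by
  have hm : Measurable fun p : ℝ × ℝ ↦ ENNReal.ofReal p.1 * F (circleMap 0 p.1 p.2) := by
    refine (ENNReal.measurable_ofReal.comp measurable_fst).mul (hF.comp ?_)
    simp only [circleMap]
    fun_prop
  have h1 : ∀ p : ℝ × ℝ, Complex.polarCoord.symm p = circleMap 0 p.1 p.2 := fun p ↦ by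
    simp [circleMap, Complex.exp_mul_I]
  rw [← Complex.lintegral_comp_polarCoord_symm]
  simp only [h1, smul_eq_mul]
  rw [polarCoord_target, Measure.volume_eq_prod, ← Measure.prod_restrict,
    lintegral_prod_symm _ hm.aemeasurable]

theorem lintegral_eq_polar_swap {F : ℂ → ℝ≥0∞} (hF : Measurable F) :
    ∫⁻ z, F z = ∫⁻ r in Ioi (0 : ℝ), ENNReal.ofReal r * ∫⁻ θ in Ioo (-π) π, F (circleMap 0 r θ) := by
  have hm : Measurable fun p : ℝ × ℝ ↦ ENNReal.ofReal p.2 * F (circleMap 0 p.2 p.1) := by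
    refine (ENNReal.measurable_ofReal.comp measurable_snd).mul (hF.comp ?_)
    simp only [circleMap]
    fun_prop
  rw [lintegral_eq_polar hF, lintegral_lintegral_swap hm.aemeasurable]
  refine lintegral_congr fun r ↦ ?_
  rw [lintegral_const_mul]
  exact hF.comp (continuous_circleMap 0 r).measurable

theorem lintegral_Ioo_inv {m : ℝ} (hm : 0 < m) (hm1 : m ≤ 1) :
    ∫⁻ r in Ioo m 1, ENNReal.ofReal r⁻¹ = ENNReal.ofReal (log (1 / m)) := by
  have hint : IntervalIntegrable (fun r : ℝ ↦ r⁻¹) volume m 1 := by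
    refine ContinuousOn.intervalIntegrable fun r hr ↦ ?_
    rw [uIcc_of_le hm1] at hr
    exact (continuousAt_inv₀ (hm.trans_le hr.1).ne').continuousWithinAt
  rw [← integral_inv_of_pos hm one_pos, intervalIntegral.integral_of_le hm1,
    ← setLIntegral_congr Ioo_ae_eq_Ioc.symm, ofReal_integral_eq_lintegral_ofReal]
  · exact (intervalIntegrable_iff_integrableOn_Ioc_of_le hm1).1 hint
  · refine (ae_restrict_iff' measurableSet_Ioc).2 (Filter.Eventually.of_forall fun r hr ↦ ?_)
    exact inv_nonneg.2 (hm.trans hr.1).le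

/-- The logarithmic area of a plane set. -/
noncomputable def logArea (E : Set ℂ) : ℝ≥0∞ := ∫⁻ z in E, ENNReal.ofReal (‖z‖ ^ 2)⁻¹

theorem measurable_ofReal_inv_norm_sq : Measurable fun z : ℂ ↦ ENNReal.ofReal (‖z‖ ^ 2)⁻¹ := by
  fun_prop

theorem volume_Ioo_neg_pi_pi : volume (Ioo (-π) π) = ENNReal.ofReal (2 * π) := by
  rw [Real.volume_Ioo]; congr 1; ring

theorem logArea_annulus_le {m : ℝ} (hm : 0 < m) (hm1 : m ≤ 1) :
    logArea (ball 0 1 \ ball 0 m) ≤ ENNReal.ofReal (2 * π * log (1 / m)) := by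
  have hE : MeasurableSet (ball (0 : ℂ) 1 \ ball 0 m) := measurableSet_ball.diff measurableSet_ball
  rw [logArea, ← lintegral_indicator hE,
    lintegral_eq_polar_swap (measurable_ofReal_inv_norm_sq.indicator hE)]
  have h1 : ∀ r ∈ Ioi (0 : ℝ), ENNReal.ofReal r * ∫⁻ θ in Ioo (-π) π,
      (ball (0 : ℂ) 1 \ ball 0 m).indicator (fun z : ℂ ↦ ENNReal.ofReal (‖z‖ ^ 2)⁻¹)
        (circleMap 0 r θ) =
      (Ico m 1).indicator (fun r ↦ ENNReal.ofReal (2 * π) * ENNReal.ofReal r⁻¹) r := by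
    intro r hr
    have hr0 : (0 : ℝ) < r := hr
    have hn : ∀ θ, ‖circleMap 0 r θ‖ = r := fun θ ↦ by
      rw [norm_circleMap_zero, abs_of_pos hr0]
    by_cases hrm : r ∈ Ico m 1
    · have h2 : ∀ θ, circleMap 0 r θ ∈ ball (0 : ℂ) 1 \ ball 0 m := fun θ ↦ by
        simp only [mem_sdiff, mem_ball_zero_iff, hn, not_lt]
        exact ⟨hrm.2, hrm.1⟩
      simp only [indicator_of_mem (h2 _), indicator_of_mem hrm, hn, lintegral_const,
        Measure.restrict_apply_univ, volume_Ioo_neg_pi_pi]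
      rw [← mul_assoc, ← ENNReal.ofReal_mul hr0.le, mul_comm]
      congr 2
      field_simp
    · have h2 : ∀ θ, circleMap 0 r θ ∉ ball (0 : ℂ) 1 \ ball 0 m := fun θ ↦ by
        simp only [mem_sdiff, mem_ball_zero_iff, hn, not_lt]
        exact fun h ↦ hrm ⟨h.2, h.1⟩
      simp [indicator_of_notMem (h2 _), indicator_of_notMem hrm]
  rw [setLIntegral_congr_fun measurableSet_Ioi h1, lintegral_indicator measurableSet_Ico,
    Measure.restrict_restrict measurableSet_Ico,
    inter_eq_left.2 (show Ico m 1 ⊆ Ioi 0 from fun r hr ↦ hm.trans_le hr.1),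
    lintegral_const_mul _ (by fun_prop), ← setLIntegral_congr Ioo_ae_eq_Ico,
    lintegral_Ioo_inv hm hm1, ← ENNReal.ofReal_mul (by positivity)]

/-- By the mean value property h² has mean h(0)² = 1 on the circle, so |h|² has mean at least 1. -/
theorem two_pi_le_lintegral_circleMap {h : ℂ → ℂ} (hh : DifferentiableOn ℂ h (ball 0 1))
    (h0 : h 0 = 1) {r : ℝ} (hr0 : 0 < r) (hr1 : r < 1) :
    ENNReal.ofReal (2 * π) ≤ ∫⁻ θ in Ioo (-π) π, ENNReal.ofReal (‖h (circleMap 0 r θ)‖ ^ 2) := by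
  have hd : DiffContOnCl ℂ (fun z ↦ h z ^ 2) (ball 0 |r|) := by
    refine DifferentiableOn.diffContOnCl ((hh.pow 2).mono ?_)
    refine closure_ball_subset_closedBall.trans (closedBall_subset_ball ?_)
    rwa [abs_of_pos hr0]
  have h1 := hd.circleAverage
  rw [Real.circleAverage_eq_integral_add (-π),
    intervalIntegral.integral_comp_add_right (fun θ ↦ h (circleMap 0 r θ) ^ 2), h0, one_pow,
    intervalIntegral.integral_of_le (by linarith [pi_pos]), integral_Ioc_eq_integral_Ioo,
    zero_add, show 2 * π + -π = π by ring] at h1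
  have h2 : ∫ θ in Ioo (-π) π, h (circleMap 0 r θ) ^ 2 = (2 * π : ℝ) := by
    have h3 : (2 * π : ℝ) ≠ 0 := by positivity
    rw [inv_smul_eq_iff₀ h3] at h1
    rw [h1]
    simp
  have h4 := enorm_integral_le_lintegral_enorm (μ := volume.restrict (Ioo (-π) π))
    (fun θ ↦ h (circleMap 0 r θ) ^ 2)
  rw [h2, ← ofReal_norm, Complex.norm_real, Real.norm_of_nonneg (by positivity)] at h4
  refine h4.trans_eq (lintegral_congr fun θ ↦ ?_)
  rw [← ofReal_norm, norm_pow]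

theorem det_smul_one_complex (a : ℂ) : ((a • (1 : ℂ →L[ℝ] ℂ))).det = ‖a‖ ^ 2 := by
  have := Algebra.norm_complex_apply a
  rw [Algebra.norm_apply, Complex.normSq_eq_norm_sq] at this
  rw [← this, ContinuousLinearMap.det]
  rfl

/-- A conformal map of the disc that fixes `0` does not decrease the logarithmic area of the annuli
`δ < |w| < 1`. -/
theorem le_logArea_image_annulus {g : ℂ → ℂ} (hg : DifferentiableOn ℂ g (ball 0 1))
    (hinj : InjOn g (ball 0 1)) (hg0 : g 0 = 0) {δ : ℝ} (hδ : 0 < δ) (hδ1 : δ ≤ 1) :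
    ENNReal.ofReal (2 * π * log (1 / δ)) ≤ logArea (g '' (ball 0 1 \ closedBall 0 δ)) := by
  classical
  set A : Set ℂ := ball 0 1 \ closedBall 0 δ with hA
  have hAo : IsOpen A := isOpen_ball.sdiff isClosed_closedBall
  have hAb : A ⊆ ball 0 1 := sdiff_subset
  have h0b : ball (0 : ℂ) 1 ∈ nhds 0 := ball_mem_nhds _ one_pos
  have hdg : DifferentiableOn ℂ (deriv g) (ball 0 1) := hg.deriv isOpen_ball
  -- `q` is g(w)/w with the singularity removed. Then `deriv g w / q w` is w g'(w)/g(w), and the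
  -- change of variables by `g` turns dx dy/|z|² into its squared modulus times dx dy/|w|².
  set q := dslope g 0 with hq
  have hqd : DifferentiableOn ℂ q (ball 0 1) := (Complex.differentiableOn_dslope h0b).2 hg
  have hq0 : q 0 = deriv g 0 := dslope_same _ _
  have hder0 : deriv g 0 ≠ 0 := fun h ↦ by
    have := deriv_leftInvOn_mul_deriv isOpen_ball hg hinj.leftInvOn_invFunOn
      (mem_ball_self (one_pos : (0 : ℝ) < 1))
    simp [h] at this
  have hqw : ∀ w, w ≠ 0 → q w = g w / w := fun w hw ↦ by
    rw [hq, dslope_of_ne _ hw, slope_def_field, hg0, sub_zero, sub_zero]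
  have hqne : ∀ w ∈ ball (0 : ℂ) 1, q w ≠ 0 := fun w hw ↦ by
    rcases eq_or_ne w 0 with rfl | hw0
    · rwa [hq0]
    · rw [hqw w hw0]
      refine div_ne_zero (fun h ↦ hw0 ?_) hw0
      exact hinj hw (mem_ball_self one_pos) (h.trans hg0.symm)
  have hh : DifferentiableOn ℂ (fun w ↦ deriv g w / q w) (ball 0 1) := hdg.div hqd hqne
  have hh0 : deriv g 0 / q 0 = 1 := by rw [hq0, div_self hder0]
  rw [logArea, lintegral_image_eq_lintegral_abs_det_fderiv_mul volume hAo.measurableSet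
    (fun w hw ↦ ((hg.differentiableAt (isOpen_ball.mem_nhds
      (hAb hw))).hasDerivAt.complexToReal_fderiv).hasFDerivWithinAt) (hinj.mono hAb)]
  simp only [det_smul_one_complex]
  set F : ℂ → ℝ≥0∞ :=
    A.piecewise (fun w ↦ ENNReal.ofReal (‖deriv g w / q w‖ ^ 2 * (‖w‖ ^ 2)⁻¹)) (fun _ ↦ 0) with hF
  have hw0 : ∀ w ∈ A, w ≠ 0 := fun w hw h ↦ hw.2 (by simp [h, hδ.le])
  have hFm : Measurable F := by
    refine ContinuousOn.measurable_piecewise ?_ continuousOn_const hAo.measurableSet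
    refine ENNReal.continuous_ofReal.comp_continuousOn (((hh.continuousOn.mono hAb).norm.pow 2).mul
      (ContinuousOn.inv₀ (by fun_prop) fun w hw ↦ ?_))
    simpa using hw0 w hw
  have h1 : ∫⁻ w in A, ENNReal.ofReal |‖deriv g w‖ ^ 2| * ENNReal.ofReal (‖g w‖ ^ 2)⁻¹ =
      ∫⁻ w, F w := by
    rw [← lintegral_indicator hAo.measurableSet]
    refine lintegral_congr fun w ↦ ?_
    by_cases hw : w ∈ A
    · have hgw : g w ≠ 0 := fun h ↦ hqne w (hAb hw) (by rw [hqw w (hw0 w hw), h, zero_div])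
      have := hw0 w hw
      rw [indicator_of_mem hw, hF, piecewise_eq_of_mem _ _ _ hw, abs_of_nonneg (by positivity),
        ← ENNReal.ofReal_mul (by positivity), hqw w this, norm_div, norm_div]
      congr 1
      have h3 := norm_ne_zero_iff.2 this
      have h4 := norm_ne_zero_iff.2 hgw
      field_simp
    · rw [indicator_of_notMem hw, hF, piecewise_eq_of_notMem _ _ _ hw]
  rw [h1, lintegral_eq_polar_swap hFm]
  calc ENNReal.ofReal (2 * π * log (1 / δ))
      = ∫⁻ r in Ioo δ 1, ENNReal.ofReal (2 * π) * ENNReal.ofReal r⁻¹ := by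
        rw [lintegral_const_mul _ (by fun_prop), lintegral_Ioo_inv hδ hδ1,
          ← ENNReal.ofReal_mul (by positivity)]
    _ ≤ ∫⁻ r in Ioo δ 1, ENNReal.ofReal r * ∫⁻ θ in Ioo (-π) π, F (circleMap 0 r θ) := by
        refine setLIntegral_mono' measurableSet_Ioo fun r hr ↦ ?_
        have hr0 : 0 < r := hδ.trans hr.1
        have hmem : ∀ θ, circleMap 0 r θ ∈ A := fun θ ↦ by
          simp only [hA, mem_sdiff, mem_ball_zero_iff, mem_closedBall_zero_iff,
            norm_circleMap_zero, abs_of_pos hr0, not_le]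
          exact ⟨hr.2, hr.1⟩
        have h2 : ∀ θ, F (circleMap 0 r θ) = ENNReal.ofReal
            (‖deriv g (circleMap 0 r θ) / q (circleMap 0 r θ)‖ ^ 2) * ENNReal.ofReal (r ^ 2)⁻¹ :=
          fun θ ↦ by
            rw [hF, piecewise_eq_of_mem _ _ _ (hmem θ), norm_circleMap_zero, abs_of_pos hr0,
              ENNReal.ofReal_mul (by positivity)]
        simp only [h2]
        rw [lintegral_mul_const' _ _ ENNReal.ofReal_ne_top]
        calc ENNReal.ofReal (2 * π) * ENNReal.ofReal r⁻¹
            = ENNReal.ofReal r * (ENNReal.ofReal (2 * π) * ENNReal.ofReal (r ^ 2)⁻¹) := by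
              rw [← ENNReal.ofReal_mul (by positivity), ← ENNReal.ofReal_mul (by positivity),
                ← ENNReal.ofReal_mul hr0.le]
              congr 1
              field_simp
          _ ≤ _ := by
              gcongr
              exact two_pi_le_lintegral_circleMap hh hh0 hr0 hr.2
    _ ≤ _ := lintegral_mono_set fun r hr ↦ hδ.trans hr.1

/-- The length-area inequality for a family of radial segments. -/
theorem sq_two_pi_mul_le {ρ : ℂ → ℝ≥0∞} (hρ : Measurable ρ) {G : Set ℂ} (hG : MeasurableSet G)
    {ℓ : ℝ≥0∞}
    (hℓ : ∀ θ : ℝ, ℓ ≤ ∫⁻ r in Ioi (0 : ℝ), G.indicator ρ (circleMap 0 r θ)) :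
    (ENNReal.ofReal (2 * π) * ℓ) ^ 2 ≤ (∫⁻ z in G, ρ z ^ 2) * logArea G := by
  have hinv : Measurable fun z : ℂ ↦ ENNReal.ofReal ‖z‖⁻¹ := by fun_prop
  have h1 : ENNReal.ofReal (2 * π) * ℓ ≤ ∫⁻ z in G, ρ z * ENNReal.ofReal ‖z‖⁻¹ := by
    calc ENNReal.ofReal (2 * π) * ℓ = ∫⁻ θ in Ioo (-π) π, ℓ := by
          rw [lintegral_const, Measure.restrict_apply_univ, volume_Ioo_neg_pi_pi, mul_comm]
      _ ≤ ∫⁻ θ in Ioo (-π) π, ∫⁻ r in Ioi (0 : ℝ), G.indicator ρ (circleMap 0 r θ) :=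
          lintegral_mono fun θ ↦ hℓ θ
      _ = ∫⁻ θ in Ioo (-π) π, ∫⁻ r in Ioi (0 : ℝ), ENNReal.ofReal r *
            (G.indicator ρ (circleMap 0 r θ) * ENNReal.ofReal ‖circleMap 0 r θ‖⁻¹) := by
          refine lintegral_congr fun θ ↦ setLIntegral_congr_fun measurableSet_Ioi fun r hr ↦ ?_
          have hr0 : (0 : ℝ) < r := hr
          rw [norm_circleMap_zero, abs_of_pos hr0, mul_left_comm, ← ENNReal.ofReal_mul hr0.le,
            mul_inv_cancel₀ hr0.ne', ENNReal.ofReal_one, mul_one]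
      _ = ∫⁻ z, G.indicator ρ z * ENNReal.ofReal ‖z‖⁻¹ :=
          (lintegral_eq_polar ((hρ.indicator hG).mul hinv)).symm
      _ = ∫⁻ z in G, ρ z * ENNReal.ofReal ‖z‖⁻¹ := by
          rw [← lintegral_indicator hG]
          refine lintegral_congr fun z ↦ ?_
          by_cases hz : z ∈ G <;> simp [hz]
  -- Cauchy–Schwarz; the factor 1/|z| comes from dr dθ = |z|⁻¹ dx dy.
  have h2 := ENNReal.lintegral_mul_le_Lp_mul_Lq (volume.restrict G)
    Real.HolderConjugate.two_two hρ.aemeasurable hinv.aemeasurable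
  have h3 : ∀ z : ℂ, ENNReal.ofReal ‖z‖⁻¹ ^ 2 = ENNReal.ofReal (‖z‖ ^ 2)⁻¹ := fun z ↦ by
    rw [← ENNReal.ofReal_pow (by positivity), inv_pow]
  simp only [ENNReal.rpow_two, h3] at h2
  calc (ENNReal.ofReal (2 * π) * ℓ) ^ 2
      ≤ ((∫⁻ z in G, ρ z ^ 2) ^ (1 / 2 : ℝ) * logArea G ^ (1 / 2 : ℝ)) ^ 2 := by
        exact pow_le_pow_left₀ zero_le (h1.trans h2) 2
    _ = _ := by
        rw [mul_pow, ← ENNReal.rpow_natCast, ← ENNReal.rpow_natCast, ← ENNReal.rpow_mul,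
          ← ENNReal.rpow_mul]
        norm_num

end Polar

/-! ### The surrounded domain and the radial hull -/

section SurroundedDomain

variable {P : Set ℂ}

theorem mem_surroundedDomain_of_isPreconnected {T : Set ℂ} (hT : IsPreconnected T) (hTP : T ⊆ Pᶜ)
    {z : ℂ} (hz : z ∈ T) (hzU : z ∈ surroundedDomain P) : T ⊆ surroundedDomain P := by
  rw [surroundedDomain, connectedComponentIn_eq hzU]
  exact hT.subset_connectedComponentIn hz hTP

/-- The outward ray is connected and unbounded, so it cannot lie in a bounded component. -/
theorem notMem_surroundedDomain_of_ray (hP : SurroundsZero P) {z : ℂ} (hz : z ≠ 0)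
    (hray : ∀ t : ℝ, 1 ≤ t → (t : ℂ) * z ∉ P) : z ∉ surroundedDomain P := by
  intro hzU
  have hsub : (fun t : ℝ ↦ (t : ℂ) * z) '' Ici 1 ⊆ surroundedDomain P :=
    mem_surroundedDomain_of_isPreconnected (isPreconnected_Ici.image _ (by fun_prop))
      (by rintro _ ⟨t, ht, rfl⟩; exact hray t ht) ⟨1, self_mem_Ici, by simp⟩ hzU
  obtain ⟨M, hM⟩ := hP.2.exists_norm_le
  have hzn : 0 < ‖z‖ := norm_pos_iff.2 hz
  have h1 := hM _ (hsub ⟨max 1 ((M + 1) / ‖z‖), mem_Ici.2 (le_max_left _ _), rfl⟩)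
  simp only at h1
  rw [norm_mul, Complex.norm_real, Real.norm_of_nonneg (zero_le_one.trans (le_max_left _ _))] at h1
  have h2 : (M + 1) / ‖z‖ * ‖z‖ ≤ max 1 ((M + 1) / ‖z‖) * ‖z‖ :=
    mul_le_mul_of_nonneg_right (le_max_right _ _) hzn.le
  rw [div_mul_cancel₀ _ hzn.ne'] at h2
  linarith

theorem isOpen_surroundedDomain (hPc : IsClosed P) : IsOpen (surroundedDomain P) :=
  hPc.isOpen_compl.connectedComponentIn

theorem zero_mem_surroundedDomain (hP : SurroundsZero P) : (0 : ℂ) ∈ surroundedDomain P :=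
  mem_connectedComponentIn hP.1

theorem surroundedDomain_subset_compl : surroundedDomain P ⊆ Pᶜ := connectedComponentIn_subset _ _

theorem surroundedDomain_subset_ball (hP : SurroundsZero P) (hP1 : P ⊆ ball 0 1) :
    surroundedDomain P ⊆ ball 0 1 := by
  intro z hz
  by_contra hz1
  rw [mem_ball_zero_iff, not_lt] at hz1
  refine notMem_surroundedDomain_of_ray hP (fun h ↦ by simp [h] at hz1; linarith)
    (fun t ht htP ↦ ?_) hz
  have := hP1 htP
  rw [mem_ball_zero_iff, norm_mul, Complex.norm_real, Real.norm_of_nonneg (by linarith)] at this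
  nlinarith

/-- The complement in the closed disc consists of the connected set `P` and the other components of
`Pᶜ`, whose union is open. -/
theorem isDiscDomain_surroundedDomain (hP : SurroundsZero P) (hP1 : P ⊆ ball 0 1)
    (hPc : IsClosed P) (hPp : IsPreconnected P) : IsDiscDomain (surroundedDomain P) := by
  have hU := isOpen_surroundedDomain hPc
  have hUb := surroundedDomain_subset_ball hP hP1
  refine ⟨hU, isPreconnected_connectedComponentIn, hUb, ?_⟩
  have hO : IsOpen (Pᶜ \ surroundedDomain P) := by
    rw [isOpen_iff_mem_nhds]
    rintro x ⟨hxP, hxU⟩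
    refine Filter.mem_of_superset (hPc.isOpen_compl.connectedComponentIn.mem_nhds
      (mem_connectedComponentIn hxP)) fun y hy ↦ ⟨connectedComponentIn_subset _ _ hy, fun hyU ↦ ?_⟩
    exact hxU (mem_surroundedDomain_of_isPreconnected isPreconnected_connectedComponentIn
      (connectedComponentIn_subset _ _) hy hyU (mem_connectedComponentIn hxP))
  refine isPreconnected_of_isOpen_inter_subset (S := closedBall 0 1) (E := P)
    (O := Pᶜ \ surroundedDomain P) (convex_closedBall _ _).isPreconnected
    ((isCompact_closedBall _ _).diff hU).isClosed ?_ hPp ?_ hO ?_ ?_ sdiff_subset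
  · exact fun h ↦ (h (mem_closedBall_self zero_le_one)).2 (zero_mem_surroundedDomain hP)
  · exact fun z hz ↦ ⟨ball_subset_closedBall (hP1 hz), fun h ↦ surroundedDomain_subset_compl h hz⟩
  · exact fun z hz ↦ ⟨hz.2, hz.1.2⟩
  · intro z hz
    by_cases hzP : z ∈ P
    · exact Or.inl hzP
    · exact Or.inr ⟨hzP, hz.2⟩

/-- The union of the radial segments that join `0` and the points of `P`. -/
def radialHull (P : Set ℂ) : Set ℂ := (fun x : ℝ × ℂ ↦ (x.1 : ℂ) * x.2) '' (Icc 0 1 ×ˢ P)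

theorem isClosed_radialHull (hPc : IsCompact P) : IsClosed (radialHull P) :=
  ((isCompact_Icc.prod hPc).image (by fun_prop)).isClosed

theorem notMem_surroundedDomain_of_notMem_radialHull (hP : SurroundsZero P) (hne : P.Nonempty)
    {z : ℂ} (hz : z ∉ radialHull P) : z ∉ P ∪ surroundedDomain P := by
  have hray : ∀ t : ℝ, 1 ≤ t → (t : ℂ) * z ∉ P := fun t ht htP ↦ by
    have ht0 : (t : ℂ) ≠ 0 := Complex.ofReal_ne_zero.2 (by linarith)
    refine hz ⟨(t⁻¹, t * z), ⟨⟨by positivity, inv_le_one_of_one_le₀ ht⟩, htP⟩, ?_⟩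
    simp only [Complex.ofReal_inv]
    rw [inv_mul_cancel_left₀ ht0]
  rintro (h | h)
  · exact hray 1 le_rfl (by simpa using h)
  · refine notMem_surroundedDomain_of_ray hP ?_ hray h
    rintro rfl
    obtain ⟨p, hp⟩ := hne
    exact hz ⟨(0, p), ⟨by simp, hp⟩, by simp⟩

/-- A ray that missed `P` would leave the disc inside the surrounded domain. A hull point beyond the
last hit `R` would put a point of `P` still farther out. -/
theorem exists_last_mem_ray (hP : SurroundsZero P) (hP1 : P ⊆ ball 0 1) (hPc : IsCompact P)
    (θ : ℝ) : ∃ R ∈ Ioo (0 : ℝ) 1, circleMap 0 R θ ∈ P ∧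
      ∀ r ∈ Ioo R 1, circleMap 0 r θ ∉ radialHull P := by
  have hlt : ∀ r, circleMap 0 r θ ∈ P → |r| < 1 := fun r hr ↦ by
    simpa [norm_circleMap_zero] using hP1 hr
  have hcont : Continuous fun r : ℝ ↦ circleMap 0 r θ := by
    simp only [circleMap]
    fun_prop
  set T : Set ℝ := Icc 0 1 ∩ (fun r : ℝ ↦ circleMap 0 r θ) ⁻¹' P with hT
  have hTc : IsCompact T := isCompact_Icc.inter_right (hPc.isClosed.preimage hcont)
  have hTne : T.Nonempty := by
    by_contra hemp
    rw [not_nonempty_iff_eq_empty] at hemp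
    have hray : ∀ r : ℝ, 0 ≤ r → circleMap 0 r θ ∉ P := fun r hr hrP ↦ by
      have h1 := (le_abs_self r).trans (hlt r hrP).le
      exact notMem_empty r (hemp ▸ ⟨⟨hr, h1⟩, hrP⟩)
    have hsub : (fun r : ℝ ↦ circleMap 0 r θ) '' Ici 0 ⊆ surroundedDomain P :=
      mem_surroundedDomain_of_isPreconnected (isPreconnected_Ici.image _ hcont.continuousOn)
        (by rintro _ ⟨r, hr, rfl⟩; exact hray r hr) ⟨0, self_mem_Ici, by simp⟩
        (zero_mem_surroundedDomain hP)
    have := surroundedDomain_subset_ball hP hP1 (hsub ⟨1, mem_Ici.2 zero_le_one, rfl⟩)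
    simp at this
  obtain ⟨R, ⟨hR01, hRP⟩, hmax⟩ := hTc.exists_isGreatest hTne
  have hR0 : R ≠ 0 := by
    rintro rfl
    exact hP.1 (by simpa using hRP)
  refine ⟨R, ⟨lt_of_le_of_ne hR01.1 hR0.symm, (le_abs_self R).trans_lt (hlt R hRP)⟩, hRP, ?_⟩
  rintro r ⟨hRr, hr1⟩ ⟨⟨s, p⟩, ⟨⟨hs0, hs1⟩, hp⟩, hsp⟩
  simp only at hs0 hs1 hp hsp
  have hr0 : 0 < r := hR01.1.trans_lt hRr
  have hs : 0 < s := by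
    refine lt_of_le_of_ne hs0 ?_
    rintro rfl
    have : circleMap 0 r θ = 0 := by rw [← hsp]; simp
    exact circleMap_ne_center hr0.ne' this
  have hpe : p = circleMap 0 (r / s) θ := by
    have hsne : (s : ℂ) ≠ 0 := Complex.ofReal_ne_zero.2 hs.ne'
    rw [← mul_right_inj' hsne, hsp]
    simp only [circleMap, zero_add, Complex.ofReal_div]
    field_simp
  rw [hpe] at hp
  have h1 : r ≤ r / s := le_div_self hr0.le hs hs1
  have h2 := hmax ⟨⟨by positivity, (le_abs_self _).trans (hlt _ hp).le⟩, hp⟩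
  linarith

end SurroundedDomain

/-! ### The two estimates and the conclusion -/

theorem iInf_curveLength_le {P : Set ℂ} {ρ : ℂ → ℝ≥0∞} (hP : SurroundsZero P)
    (hP1 : P ⊆ ball 0 1) (hPc : IsCompact P) (θ : ℝ) :
    ⨅ c ∈ joiningCurves (annularDomain P) (sphere 0 1) P, curveLength ρ c ≤
      ∫⁻ r in Ioi (0 : ℝ), (ball 0 1 \ radialHull P).indicator ρ (circleMap 0 r θ) := by
  obtain ⟨R, ⟨hR0, hR1⟩, hRP, hRr⟩ := exists_last_mem_ray hP hP1 hPc θ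
  have hsub : ∀ r ∈ Ioo R 1, circleMap 0 r θ ∈ ball (0 : ℂ) 1 \ radialHull P := fun r hr ↦ by
    refine ⟨?_, hRr r hr⟩
    rw [mem_ball_zero_iff, norm_circleMap_zero, abs_of_pos (hR0.trans hr.1)]
    exact hr.2
  set c : ℝ → ℂ := fun t ↦ circleMap 0 (1 - t * (1 - R)) θ with hc
  set v : ℂ := (1 - R : ℝ) * Complex.exp (θ * Complex.I) with hv
  have hvn : ‖v‖ = 1 - R := by
    rw [hv, norm_mul, Complex.norm_exp_ofReal_mul_I, mul_one, Complex.norm_real,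
      Real.norm_of_nonneg (by linarith)]
  have hcv : ∀ t, c t = Complex.exp (θ * Complex.I) - t * v := fun t ↦ by
    simp only [hc, hv, circleMap]
    push_cast
    ring
  have hIoo : ∀ t ∈ Ioo (0 : ℝ) 1, 1 - t * (1 - R) ∈ Ioo R 1 := fun t ht ↦ by
    constructor <;> nlinarith [ht.1, ht.2]
  have hmem : c ∈ joiningCurves (annularDomain P) (sphere 0 1) P := by
    refine ⟨⟨‖v‖₊, (LipschitzWith.of_dist_le_mul fun s t ↦ ?_).lipschitzOnWith⟩, ?_, ?_,
      fun t ht ↦ ?_⟩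
    · rw [hcv, hcv, dist_eq_norm, sub_sub_sub_cancel_left, ← sub_mul, norm_mul, mul_comm,
        ← Complex.ofReal_sub, Complex.norm_real, dist_comm, dist_eq_norm, coe_nnnorm]
    · simp [hc]
    · simpa [hc] using hRP
    · have h1 := hsub _ (hIoo t ht)
      exact ⟨h1.1, notMem_surroundedDomain_of_notMem_radialHull hP ⟨_, hRP⟩ h1.2⟩
  have hderiv : ∀ t, ‖deriv c t‖ₑ = ENNReal.ofReal |-(1 - R)| := fun t ↦ by
    have h1 : HasDerivAt c (-v) t := by
      rw [show c = fun t : ℝ ↦ Complex.exp (θ * Complex.I) - t * v from funext hcv]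
      simpa using ((Complex.ofRealCLM.hasDerivAt (x := t)).mul_const v).const_sub
        (Complex.exp (θ * Complex.I))
    rw [h1.deriv, ← ofReal_norm, norm_neg, hvn, abs_neg, abs_of_pos (by linarith)]
  refine (iInf₂_le c hmem).trans ?_
  have himg : (fun t : ℝ ↦ 1 - t * (1 - R)) '' Ioo 0 1 ⊆ Ioo R 1 := by
    rintro _ ⟨t, ht, rfl⟩
    exact hIoo t ht
  calc curveLength ρ c
      = ∫⁻ t in Ioo (0 : ℝ) 1, ENNReal.ofReal |-(1 - R)| *
          ρ (circleMap 0 (1 - t * (1 - R)) θ) := by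
        simp only [curveLength, hderiv]
        exact lintegral_congr fun t ↦ mul_comm _ _
    _ = ∫⁻ r in (fun t : ℝ ↦ 1 - t * (1 - R)) '' Ioo 0 1, ρ (circleMap 0 r θ) := by
        refine (lintegral_image_eq_lintegral_abs_deriv_mul (f := fun t ↦ 1 - t * (1 - R))
          (f' := fun _ ↦ -(1 - R)) measurableSet_Ioo (fun t _ ↦ ?_) (fun s _ t _ h ↦ ?_)
          (fun r ↦ ρ (circleMap 0 r θ))).symm
        · simpa using (((hasDerivAt_id t).mul_const (1 - R)).const_sub 1).hasDerivWithinAt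
        · have h1 : s * (1 - R) = t * (1 - R) := by linarith [show 1 - s * (1 - R) = _ from h]
          exact mul_right_cancel₀ (by linarith : 1 - R ≠ 0) h1
    _ ≤ ∫⁻ r in Ioo R 1, ρ (circleMap 0 r θ) := lintegral_mono_set himg
    _ = ∫⁻ r in Ioo R 1, (ball 0 1 \ radialHull P).indicator ρ (circleMap 0 r θ) :=
        setLIntegral_congr_fun measurableSet_Ioo fun r hr ↦
          (indicator_of_mem (hsub r hr) _).symm
    _ ≤ _ := lintegral_mono_set fun r hr ↦ hR0.trans hr.1

/-- A set in the disc outside of `U` has logarithmic area at most `2 π log φ'(0)`, where `φ` is the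
normalized Riemann map of `U`. -/
theorem logArea_le_of_isNormalizedRiemannMap {U G : Set ℂ} {φ : ℂ → ℂ} (hU : IsOpen U)
    (h0 : 0 ∈ U) (hU1 : U ⊆ ball 0 1) (hφ : IsNormalizedRiemannMap U 0 φ)
    (hG1 : G ⊆ ball 0 1) (hGU : Disjoint G U) :
    1 ≤ (deriv φ 0).re ∧ logArea G ≤ ENNReal.ofReal (2 * Real.pi * Real.log (deriv φ 0).re) := by
  obtain ⟨hφd, hφb, hφ0, ha, him⟩ := hφ
  set a := (deriv φ 0).re with ha_def
  have hnorm : ‖deriv φ 0‖ = a := by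
    rw [show deriv φ 0 = (a : ℂ) from Complex.ext rfl (by simp [him]), Complex.norm_real,
      Real.norm_of_nonneg ha.le]
  set g := Function.invFunOn φ U with hg
  have hgl : LeftInvOn g φ U := hφb.injOn.leftInvOn_invFunOn
  have hgU : MapsTo g (ball 0 1) U := fun w hw ↦ Function.invFunOn_mem (hφb.surjOn hw)
  have hφg : ∀ w ∈ ball (0 : ℂ) 1, φ (g w) = w := fun w hw ↦
    Function.invFunOn_eq (hφb.surjOn hw)
  have hgd : DifferentiableOn ℂ g (ball 0 1) := fun w hw ↦ by
    obtain ⟨z, hz, rfl⟩ := hφb.surjOn hw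
    exact (differentiableAt_leftInvOn hU hφd hgl hz).differentiableWithinAt
  have hginj : InjOn g (ball 0 1) := fun z hz w hw h ↦ by rw [← hφg z hz, h, hφg w hw]
  have hg0 : g 0 = 0 := by
    have := hgl h0
    rwa [hφ0] at this
  -- The slack between `a` and `b` gives |φ(z)| ≤ b|z| near 0; `b` decreases to `a` at the end.
  have key : ∀ b, a < b →
      1 ≤ b ∧ logArea G ≤ ENNReal.ofReal (2 * Real.pi * Real.log b) := by
    intro b hb
    have hb0 : 0 < b := ha.trans hb
    have hd := (hφd.differentiableAt (hU.mem_nhds h0)).hasDerivAt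
    have hev := (hasDerivAt_iff_tendsto_slope.1 hd).norm.eventually_lt_const (by rwa [hnorm])
    rw [eventually_nhdsWithin_iff] at hev
    obtain ⟨ε, hε, hball⟩ := Metric.eventually_nhds_iff_ball.1 (hev.and (hU.mem_nhds h0))
    set m := min ε (min 1 (1 / b)) with hm
    have hm0 : 0 < m := lt_min hε (lt_min one_pos (by positivity))
    have hm1 : m ≤ 1 := (min_le_right _ _).trans (min_le_left _ _)
    have hbm : b * m ≤ 1 := by
      have : m ≤ 1 / b := (min_le_right _ _).trans (min_le_right _ _)
      rw [le_div_iff₀ hb0] at this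
      linarith
    have hmU : ball 0 m ⊆ U := fun z hz ↦ (hball z (ball_subset_ball (min_le_left _ _) hz)).2
    have hφm : ∀ z ∈ ball (0 : ℂ) m, ‖φ z‖ ≤ b * m := fun z hz ↦ by
      have h1 := (hball z (ball_subset_ball (min_le_left _ _) hz)).1
      rcases eq_or_ne z 0 with rfl | hz0
      · rw [hφ0, norm_zero]; positivity
      · have hzn := norm_pos_iff.2 hz0
        replace h1 := h1 hz0
        rw [slope_def_field, hφ0, sub_zero, sub_zero, norm_div, div_lt_iff₀ hzn] at h1
        rw [mem_ball_zero_iff] at hz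
        nlinarith
    set A := g '' (ball 0 1 \ closedBall 0 (b * m)) with hA
    have hAo : IsOpen A := isOpen_image_of_injOn (isOpen_ball.sdiff isClosed_closedBall)
      (hgd.mono sdiff_subset) (hginj.mono sdiff_subset)
    have hAU : A ⊆ U := by
      rintro _ ⟨w, hw, rfl⟩
      exact hgU hw.1
    have hsub : G ∪ A ⊆ ball 0 1 \ ball 0 m := by
      rintro z (hz | hz)
      · exact ⟨hG1 hz, fun h ↦ disjoint_left.1 hGU hz (hmU h)⟩
      · refine ⟨hU1 (hAU hz), fun h ↦ ?_⟩
        obtain ⟨w, hw, rfl⟩ := hz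
        have h1 := hφm _ h
        rw [hφg w hw.1] at h1
        exact hw.2 (by simpa using h1)
    -- `G` and the image `A` of the annulus bm < |w| < 1 are disjoint and both lie in m ≤ |z| < 1.
    have hsum : logArea G + ENNReal.ofReal (2 * Real.pi * Real.log (1 / (b * m))) ≤
        ENNReal.ofReal (2 * Real.pi * Real.log (1 / m)) := by
      calc _ ≤ logArea G + logArea A := by
            gcongr
            exact le_logArea_image_annulus hgd hginj hg0 (by positivity) hbm
        _ = logArea (G ∪ A) :=
            (lintegral_union hAo.measurableSet (hGU.mono_right hAU)).symm
        _ ≤ logArea (ball 0 1 \ ball 0 m) := lintegral_mono_set hsub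
        _ ≤ _ := logArea_annulus_le hm0 hm1
    have hlog : Real.log (1 / m) = Real.log b + Real.log (1 / (b * m)) := by
      rw [one_div, one_div, Real.log_inv, Real.log_inv, Real.log_mul hb0.ne' hm0.ne']
      ring
    have hnn : 0 ≤ Real.log (1 / (b * m)) :=
      Real.log_nonneg ((one_le_div (by positivity)).2 hbm)
    have hnn' : 0 ≤ Real.log (1 / m) := Real.log_nonneg ((one_le_div hm0).2 hm1)
    have hπ := Real.pi_pos
    constructor
    · have h1 := (ENNReal.ofReal_le_ofReal_iff (by positivity)).1 (le_add_self.trans hsum)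
      have h2 : 0 ≤ Real.log b := by
        have := le_of_mul_le_mul_left h1 (by positivity)
        linarith
      by_contra! hlt
      exact absurd (Real.log_neg hb0 hlt) (not_lt.2 h2)
    · have h1 := ENNReal.le_sub_of_add_le_right ENNReal.ofReal_ne_top hsum
      rw [← ENNReal.ofReal_sub _ (by positivity), hlog] at h1
      convert h1 using 2
      ring
  refine ⟨le_of_forall_gt_imp_ge_of_dense fun b hb ↦ (key b hb).1, ?_⟩
  have hcont : ContinuousAt (fun b ↦ ENNReal.ofReal (2 * Real.pi * Real.log b)) a :=
    ENNReal.continuous_ofReal.continuousAt.comp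
      (continuousAt_const.mul (Real.continuousAt_log ha.ne'))
  refine ge_of_tendsto (hcont.tendsto.mono_left (nhdsWithin_le_nhds (s := Ioi a))) ?_
  filter_upwards [self_mem_nhdsWithin] with b hb
  exact (key b hb).2

theorem extremalDistance_le_of_isNormalizedRiemannMap {P : Set ℂ} {φ : ℂ → ℂ}
    (hP : SurroundsZero P) (hP1 : P ⊆ ball 0 1) (hPc : IsCompact P) (hne : P.Nonempty)
    (hφ : IsNormalizedRiemannMap (surroundedDomain P) 0 φ) :
    1 ≤ (deriv φ 0).re ∧ extremalDistance (annularDomain P) (sphere 0 1) P ≤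
      ENNReal.ofReal ((2 * Real.pi)⁻¹ * Real.log (deriv φ 0).re) := by
  set G : Set ℂ := ball 0 1 \ radialHull P with hG
  have hGm : MeasurableSet G := measurableSet_ball.diff (isClosed_radialHull hPc).measurableSet
  have hGA : G ⊆ annularDomain P := fun z hz ↦
    ⟨hz.1, notMem_surroundedDomain_of_notMem_radialHull hP hne hz.2⟩
  obtain ⟨ha, hlog⟩ := logArea_le_of_isNormalizedRiemannMap (isOpen_surroundedDomain hPc.isClosed)
    (zero_mem_surroundedDomain hP) (surroundedDomain_subset_ball hP hP1) hφ sdiff_subset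
    (disjoint_left.2 fun z hz hzU ↦ (hGA hz).2 (Or.inr hzU))
  refine ⟨ha, iSup_le fun ρ ↦ iSup_le fun hρ ↦ iSup_le fun _ ↦ iSup_le fun _ ↦ ?_⟩
  refine ENNReal.div_le_of_le_mul ?_
  have hπ := Real.pi_pos
  have h1 := sq_two_pi_mul_le hρ hGm (fun θ ↦ iInf_curveLength_le (ρ := ρ) hP hP1 hPc θ)
  have h2 : ENNReal.ofReal (2 * Real.pi) ^ 2 ≠ 0 := by
    simpa using hπ
  -- Both sides are multiplied by (2π)² to meet the length-area inequality.
  refine (ENNReal.mul_le_mul_iff_right h2 (ENNReal.pow_ne_top ENNReal.ofReal_ne_top)).1 ?_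
  rw [← mul_pow]
  refine h1.trans ?_
  calc (∫⁻ z in G, ρ z ^ 2) * logArea G
      ≤ metricArea ρ (annularDomain P) *
          ENNReal.ofReal (2 * Real.pi * Real.log (deriv φ 0).re) :=
        mul_le_mul' (lintegral_mono_set hGA) hlog
    _ = _ := by
        rw [mul_comm, ← mul_assoc, ← ENNReal.ofReal_pow (by positivity),
          ← ENNReal.ofReal_mul (by positivity)]
        congr 2
        field_simp

theorem mainTheorem11 (γ : Circle → ℂ) (hγ : Continuous γ) (hinj : Function.Injective γ)
    (hdisc : Set.range γ ⊆ Metric.ball 0 1) (hpos : 0 < Metric.infDist 0 (Set.range γ))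
    (hsur : SurroundsZero (Set.range γ)) :
    ((extremalDistance (annularDomain (Set.range γ)) (Metric.sphere 0 1) (Set.range γ) : ENNReal) :
        EReal) ≤
      ((-(2 * Real.pi)⁻¹ * Real.log (conformalRadius 0 (surroundedDomain (Set.range γ))) : ℝ) :
        EReal) := by
  have hPc : IsCompact (range γ) := isCompact_range hγ
  have hex := (isDiscDomain_surroundedDomain hsur hdisc hPc.isClosed
    (isPreconnected_range hγ)).exists_isNormalizedRiemannMap (zero_mem_surroundedDomain hsur)
  obtain ⟨ha, hle⟩ := extremalDistance_le_of_isNormalizedRiemannMap hsur hdisc hPc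
    (range_nonempty γ) hex.choose_spec
  -- Existence of a Riemann map excludes the default value 0 of `conformalRadius`.
  have hcr : -(2 * Real.pi)⁻¹ * Real.log (conformalRadius 0 (surroundedDomain (range γ))) =
      (2 * Real.pi)⁻¹ * Real.log (deriv hex.choose 0).re := by
    rw [conformalRadius, dif_pos hex, Real.log_inv]
    ring
  have hnn : 0 ≤ (2 * Real.pi)⁻¹ * Real.log (deriv hex.choose 0).re :=
    mul_nonneg (by positivity) (Real.log_nonneg ha)
  -- `ENNReal.ofReal` truncates at 0; since φ'(0) ≥ 1, nothing is lost.
  rw [hcr, ← max_eq_left hnn, ← EReal.coe_ennreal_ofReal]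
  exact EReal.coe_ennreal_le_coe_ennreal_iff.2 hle
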